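/- A representation of a set $X$ is a surjective partial function $\delta:\subseteq\mathbb{N}^{\mathbb{N}}\to X$; $p$ is a name of $x$ if $\delta(p)=x$. A partial function $F:\subseteq\mathbb{N}^{\mathbb{N}}\to\mathbb{N}^{\mathbb{N}}$ realizes a partial multi-valued function $f:\subseteq X\rightrightarrows Y$ between represented spaces, written $F\vdash f$, if for every name $p$ of a point $x\in\mathrm{dom}(f)$, $F(p)$ is defined and is a name of an element of $f(x)$. We write $f\leq_{\mathrm W}g$ if there are (Type-2) computable partial functions $H,K:\subseteq\mathbb{N}^{\mathbb{N}}\to\mathbb{N}^{\mathbb{N}}$ such that $\big(p\mapsto H\langle p,G(K(p))\rangle\big)\vdash f$ whenever $G\vdash g$, and $f\equiv_{\mathrm W}g$ (Weihrauch equivalence) if $f\leq_{\mathrm W}g$ and $g\leq_{\mathrm W}f$. Fix an effective enumeration $\alpha$ of $\mathbb{Q}^n$ and an effective enumeration $(B_k)_k$ of the open balls of $\mathbb{R}^n$ (with the Euclidean metric $d$) with centre in $\mathbb{Q}^n$ and nonnegative rational radius. A name of $x\in\mathbb{R}^n$ is a $p$ with $d(\alpha(p(i)),\alpha(p(j)))\le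 2^{-i}$ for all $i\le j$ and $\lim_i\alpha(p(i))=x$; a positive-information name of a nonempty closed $A\subseteq\mathbb{R}^n$ is a $p$ whose range is $\{k: B_k\cap A\neq\emptyset\}$; pairs are represented by pairing names, and points of $2^{\mathbb{N}}$ by themselves. For $\varepsilon>0$, the $\varepsilon$-approximate positive projection operator $\varepsilon\text{-}\mathrm{Proj}^+_{\mathbb{R}^n}$ maps a point $x\in\mathbb{R}^n$ and a nonempty closed $A\subseteq\mathbb{R}^n$, given by positive information, to the set of all $y\in A$ with $d(x,y)\le(1+\varepsilon)\,d(x,A)$. The function $\mathrm{Sort}:2^{\mathbb{N}}\to2^{\mathbb{N}}$ is defined by $\mathrm{Sort}(p)=0^m1^{\mathbb{N}}$ if $p$ contains exactly $m$ occurrences of $0$, and $\mathrm{Sort}(p)=0^{\mathbb{N}}$ if $p$ contains infinitely many occurrences of $0$. Then, for every real $\varepsilon>0$ and every $n\ge1$, $$\varepsilon\text{-}\mathrm{Proj}^+_{\mathbb{R}^n}\equiv_{\mathrm W}\mathrm{Sort}.$$ -/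

import Mathlib

open Filter Topology TopologicalSpace Metric

/-! ### Type-2 computability on Baire space -/

/-- The finite word `p(0) … p(k-1)`. -/
def initialWord (p : ℕ → ℕ) (k : ℕ) : List ℕ :=
  List.ofFn fun i : Fin k => p i

/-- Computability of a partial function `F :⊆ ℕ^ℕ → ℕ^ℕ` on Baire space (Type-2 machines): there is
a computable map `h` sending the word of input symbols read so far to the word of output symbols
written so far; written output is never revised (monotonicity), and on every `p ∈ dom F` the words
written are initial words of `F(p)` of unbounded length.  Nothing is required off `dom F`. -/
def TypeTwoComputable (F : (ℕ → ℕ) →. (ℕ → ℕ)) : Prop :=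
  ∃ h : List ℕ → List ℕ, Computable h ∧
    (∀ u v : List ℕ, u <+: v → h u <+: h v) ∧
    ∀ p q : ℕ → ℕ, q ∈ F p →
      (∀ k, ∃ m, h (initialWord p k) = initialWord q m) ∧
      ∀ m, ∃ k, m ≤ (h (initialWord p k)).length

/-- The pairing `⟨p, q⟩` of two elements of Baire space. -/
def pairName (p q : ℕ → ℕ) : ℕ → ℕ := fun i => Nat.pair (p i) (q i)

/-! ### Representations, realizers, Weihrauch reducibility -/

/-- A representation of `X`: a surjective partial function `δ :⊆ ℕ^ℕ → X`, given by its graph;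
`IsName p x` says `δ(p) = x`. -/
structure BaireRep (X : Type*) where
  IsName : (ℕ → ℕ) → X → Prop
  unique : ∀ {p x y}, IsName p x → IsName p y → x = y
  surjective : ∀ x, ∃ p, IsName p x

/-- The product representation: `⟨p, q⟩` names `(x, y)` iff `p` names `x` and `q` names `y`. -/
def BaireRep.prod {X Y : Type*} (δX : BaireRep X) (δY : BaireRep Y) :
    BaireRep (X × Y) where
  IsName r z := ∃ p q, r = pairName p q ∧ δX.IsName p z.1 ∧ δY.IsName q z.2
  unique := by
    rintro r ⟨x, y⟩ ⟨x', y'⟩ ⟨p, q, rfl, hx, hy⟩ ⟨p', q', h, hx', hy'⟩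
    have hpq : ∀ i, p i = p' i ∧ q i = q' i := fun i => Nat.pair_eq_pair.1 (congrFun h i)
    obtain rfl : p = p' := funext fun i => (hpq i).1
    obtain rfl : q = q' := funext fun i => (hpq i).2
    exact Prod.ext (δX.unique hx hx') (δY.unique hy hy')
  surjective := by
    rintro ⟨x, y⟩
    obtain ⟨p, hp⟩ := δX.surjective x
    obtain ⟨q, hq⟩ := δY.surjective y
    exact ⟨_, p, q, rfl, hp, hq⟩

/-- `G ⊢ g` for a partial multi-valued function `g :⊆ X ⇉ Y`, given as `g : X → Set Y` with domain
`{x | g x ≠ ∅}`: whenever `p` names some `x ∈ dom g`, the value `G(p)` is defined and names some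
element of `g x`. -/
def Realizes {X Y : Type*} (δX : BaireRep X) (δY : BaireRep Y)
    (G : (ℕ → ℕ) →. (ℕ → ℕ)) (g : X → Set Y) : Prop :=
  ∀ p x, δX.IsName p x → (g x).Nonempty → ∃ q ∈ G p, ∃ y ∈ g x, δY.IsName q y

/-- `f ≤_W g`: there are computable `H`, `K` such that `p ↦ H⟨p, G(K(p))⟩` realizes `f`
whenever `G` realizes `g`. -/
def WeihrauchReducible {X Y Z W : Type*}
    (δX : BaireRep X) (δY : BaireRep Y) (f : X → Set Y)
    (δZ : BaireRep Z) (δW : BaireRep W) (g : Z → Set W) : Prop :=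
  ∃ H K : (ℕ → ℕ) →. (ℕ → ℕ), TypeTwoComputable H ∧ TypeTwoComputable K ∧
    ∀ G : (ℕ → ℕ) →. (ℕ → ℕ), Realizes δZ δW G g →
      Realizes δX δY (fun p => (K p).bind fun r => (G r).bind fun q => H (pairName p q)) f

/-- `f ≡_W g`. -/
def WeihrauchEquivalent {X Y Z W : Type*}
    (δX : BaireRep X) (δY : BaireRep Y) (f : X → Set Y)
    (δZ : BaireRep Z) (δW : BaireRep W) (g : Z → Set W) : Prop :=
  WeihrauchReducible δX δY f δZ δW g ∧ WeihrauchReducible δZ δW g δX δY f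

/-! ### The function `Sort` on Cantor space -/

/-- Points of Cantor space are named by themselves. -/
def cantorRep : BaireRep (ℕ → Fin 2) where
  IsName p x := ∀ i, p i = (x i : ℕ)
  unique := fun hx hy => funext fun i => Fin.ext ((hx i).symm.trans (hy i))
  surjective := fun x => ⟨fun i => (x i : ℕ), fun _ => rfl⟩

open Classical in
/-- `Sort(p) = 0ⁿ1^ℕ` if `p` has exactly `n` occurrences of `0`, and `Sort(p) = 0^ℕ` if `p` has
infinitely many. -/
noncomputable def sortFun (p : ℕ → Fin 2) : ℕ → Fin 2 :=
  if {i | p i = 0}.Finite then fun m => if m < {i | p i = 0}.ncard then 0 else 1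
  else fun _ => 0

/-! ### Metric spaces with a dense sequence -/

section MetricReps

variable {X : Type*} [MetricSpace X]

/-- The Cauchy representation with respect to the dense sequence `α`. -/
def cauchyRep (α : ℕ → X) (hα : DenseRange α) : BaireRep X where
  IsName p x := (∀ i j, i ≤ j → dist (α (p i)) (α (p j)) ≤ (1 / 2 : ℝ) ^ i) ∧
    Tendsto (fun i => α (p i)) atTop (𝓝 x)
  unique := fun hx hy => tendsto_nhds_unique hx.2 hy.2
  surjective := fun x => by
    have h : ∀ i : ℕ, ∃ k, dist (α k) x < (1 / 2 : ℝ) ^ i / 2 := fun i => by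
      obtain ⟨k, hk⟩ := hα.exists_dist_lt x (show (0 : ℝ) < (1 / 2 : ℝ) ^ i / 2 by positivity)
      exact ⟨k, by rwa [dist_comm]⟩
    choose p hp using h
    refine ⟨p, fun i j hij => ?_, ?_⟩
    · have h1 := dist_triangle_right (α (p i)) (α (p j)) x
      have h2 : (1 / 2 : ℝ) ^ j ≤ (1 / 2 : ℝ) ^ i :=
        pow_le_pow_of_le_one (by norm_num) (by norm_num) hij
      linarith [hp i, hp j]
    · rw [tendsto_iff_dist_tendsto_zero]
      have h0 : Tendsto (fun i : ℕ => (1 / 2 : ℝ) ^ i / 2) atTop (𝓝 0) := by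
        simpa using (tendsto_pow_atTop_nhds_zero_of_lt_one (r := (1 / 2 : ℝ))
          (by norm_num) (by norm_num)).div_const 2
      exact squeeze_zero (fun _ => dist_nonneg) (fun i => (hp i).le) h0

/-- An effective enumeration of the nonnegative rational numbers. -/
def nonnegRatEnum (m : ℕ) : ℚ := (m.unpair.1 : ℚ) / ((m.unpair.2 : ℚ) + 1)

/-- The basic open ball `B_k = B(α(n), q_m)`, `k = ⟨n, m⟩`. -/
def basicBall (α : ℕ → X) (k : ℕ) : Set X :=
  ball (α k.unpair.1) (nonnegRatEnum k.unpair.2 : ℝ)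

theorem exists_nonnegRatEnum_eq {q : ℚ} (hq : 0 ≤ q) : ∃ m, nonnegRatEnum m = q := by
  refine ⟨Nat.pair q.num.toNat (q.den - 1), ?_⟩
  have h1 : ((q.num.toNat : ℤ)) = q.num := Int.toNat_of_nonneg (Rat.num_nonneg.2 hq)
  have h2 : ((q.den - 1 : ℕ) : ℚ) + 1 = q.den := by
    exact_mod_cast Nat.sub_add_cancel q.pos
  have h3 : ((q.num.toNat : ℕ) : ℚ) = (q.num : ℚ) := by exact_mod_cast congrArg (Int.cast : ℤ → ℚ) h1
  simp only [nonnegRatEnum, Nat.unpair_pair]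
  rw [h2, h3, Rat.num_div_den]

theorem exists_basicBall_mem {α : ℕ → X} (hα : DenseRange α) (x : X) {r : ℝ} (hr : 0 < r) :
    ∃ k, x ∈ basicBall α k ∧ basicBall α k ⊆ ball x r := by
  obtain ⟨n, hn⟩ := hα.exists_dist_lt x (half_pos hr)
  obtain ⟨q, hq1, hq2⟩ := exists_rat_btwn hn
  have hq0 : (0 : ℝ) ≤ q := dist_nonneg.trans hq1.le
  obtain ⟨m, hm⟩ := exists_nonnegRatEnum_eq (q := q) (by exact_mod_cast hq0)
  refine ⟨Nat.pair n m, ?_, ?_⟩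
  · simpa [basicBall, hm] using hq1
  · intro y hy
    simp only [basicBall, Nat.unpair_pair, hm, mem_ball] at hy ⊢
    have h1 := dist_triangle y (α n) x
    rw [dist_comm (α n) x] at h1
    linarith

/-- The nonempty closed subsets of `X`. -/
abbrev NonemptyClosed (X : Type*) [MetricSpace X] : Type _ :=
  {A : Set X // IsClosed A ∧ A.Nonempty}

/-- Positive information on closed sets: `p` names `A` iff `p` enumerates exactly the indices of the
basic open balls that meet `A`.  (As `range p` is never empty, only nonempty sets have names.) -/
def positiveRep (α : ℕ → X) (hα : DenseRange α) : BaireRep (NonemptyClosed X) where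
  IsName p A := ∀ k, k ∈ Set.range p ↔ (basicBall α k ∩ A.1).Nonempty
  unique := by
    have key : ∀ (A B : NonemptyClosed X),
        (∀ k, (basicBall α k ∩ A.1).Nonempty → (basicBall α k ∩ B.1).Nonempty) → A.1 ⊆ B.1 := by
      intro A B h x hx
      by_contra hxB
      obtain ⟨r, hr, hrB⟩ := Metric.isOpen_iff.1 B.2.1.isOpen_compl x hxB
      obtain ⟨k, hk1, hk2⟩ := exists_basicBall_mem hα x hr
      obtain ⟨y, hy1, hy2⟩ := h k ⟨x, hk1, hx⟩
      exact hrB (hk2 hy1) hy2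
    intro p A B hA hB
    exact Subtype.ext (Set.Subset.antisymm
      (key A B fun k hk => (hB k).1 ((hA k).2 hk)) (key B A fun k hk => (hA k).1 ((hB k).2 hk)))
  surjective := fun A => by
    obtain ⟨x, hx⟩ := A.2.2
    obtain ⟨k, hk, -⟩ := exists_basicBall_mem hα x one_pos
    obtain ⟨p, hp⟩ := (Set.to_countable {k | (basicBall α k ∩ A.1).Nonempty}).exists_eq_range
      ⟨k, x, hk, hx⟩
    exact ⟨p, fun k => by rw [← hp]; rfl⟩

/-- The `ε`-projection points of `x` onto `A`: the `y ∈ A` with `d(x, y) ≤ (1 + ε) d(x, A)`. -/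
def approxProj (ε : ℝ) (z : X × NonemptyClosed X) : Set X :=
  {y | y ∈ z.2.1 ∧ dist z.1 y ≤ (1 + ε) * infDist z.1 z.2.1}

end MetricReps

/-! ### Euclidean space with the rational points -/

/-- An effective enumeration of `ℚ`: `⟨⟨a, b⟩, c⟩ ↦ (a - b) / (c + 1)`. -/
def ratEnum (k : ℕ) : ℚ :=
  ((k.unpair.1.unpair.1 : ℚ) - (k.unpair.1.unpair.2 : ℚ)) / ((k.unpair.2 : ℚ) + 1)

/-- The `i`-th entry of the sequence `⟨k₀, ⟨k₁, ⟨k₂, …⟩⟩⟩` coded by `k`. -/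
def codeEntry (k i : ℕ) : ℕ := (Nat.unpair ((fun m => (Nat.unpair m).2)^[i] k)).1

/-- An effective enumeration of `ℚⁿ`, as a sequence in Euclidean `ℝⁿ`. -/
noncomputable def ratPoint (n : ℕ) (k : ℕ) : EuclideanSpace ℝ (Fin n) :=
  WithLp.toLp 2 fun i => ((ratEnum (codeEntry k i) : ℚ) : ℝ)

theorem ratEnum_surjective : Function.Surjective ratEnum := fun q => by
  refine ⟨Nat.pair (Nat.pair q.num.toNat (-q.num).toNat) (q.den - 1), ?_⟩
  have h1 : ((q.num.toNat : ℤ)) - ((-q.num).toNat : ℤ) = q.num := Int.toNat_sub_toNat_neg _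
  have h2 : ((q.den - 1 : ℕ) : ℚ) + 1 = q.den := by
    exact_mod_cast Nat.sub_add_cancel q.pos
  have h3 : ((q.num.toNat : ℕ) : ℚ) - (((-q.num).toNat : ℕ) : ℚ) = (q.num : ℚ) := by
    exact_mod_cast congrArg (Int.cast : ℤ → ℚ) h1
  simp only [ratEnum, Nat.unpair_pair]
  rw [h2, h3, Rat.num_div_den]

theorem exists_codeEntry_eq (n : ℕ) (f : ℕ → ℕ) : ∃ k, ∀ i < n, codeEntry k i = f i := by
  induction n generalizing f with
  | zero => exact ⟨0, by simp⟩
  | succ n ih =>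
    obtain ⟨k, hk⟩ := ih fun i => f (i + 1)
    refine ⟨Nat.pair (f 0) k, fun i hi => ?_⟩
    cases i with
    | zero => simp [codeEntry]
    | succ i => simpa [codeEntry] using hk i (by omega)

theorem denseRange_ratPoint (n : ℕ) : DenseRange (ratPoint n) := by
  have h1 : DenseRange fun v : Fin n → ℚ => (fun i => ((v i : ℚ) : ℝ)) :=
    DenseRange.piMap (f := fun (_ : Fin n) (q : ℚ) => (q : ℝ)) fun _ => Rat.denseRange_cast
  have h2 : DenseRange fun v : Fin n → ℚ =>
      (WithLp.toLp 2 (fun i => ((v i : ℚ) : ℝ)) : EuclideanSpace ℝ (Fin n)) :=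
    (WithLp.toLp_surjective 2).denseRange.comp h1 (PiLp.continuous_toLp 2 _)
  refine h2.mono ?_
  rintro _ ⟨v, rfl⟩
  choose g hg using fun i => ratEnum_surjective (v i)
  obtain ⟨k, hk⟩ := exists_codeEntry_eq n fun i => if h : i < n then g ⟨i, h⟩ else 0
  refine ⟨k, ?_⟩
  simp only [ratPoint]
  congr 1
  funext i
  rw [hk i i.2]
  simp [hg]

/-- The Cauchy representation of `ℝⁿ`. -/
noncomputable def euclideanRep (n : ℕ) : BaireRep (EuclideanSpace ℝ (Fin n)) :=
  cauchyRep (ratPoint n) (denseRange_ratPoint n)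

/-- The positive information representation of the nonempty closed subsets of `ℝⁿ`. -/
noncomputable def euclideanClosedRep (n : ℕ) :
    BaireRep (NonemptyClosed (EuclideanSpace ℝ (Fin n))) :=
  positiveRep (ratPoint n) (denseRange_ratPoint n)

/-! ### A machine model on Baire space -/

/-! Both reductions rest on one fact about sorting (`sortFun_eq_zero_iff`): the `j`-th symbol of the
sorted sequence is `0` exactly when more than `j` zeros ever appear. One call to `Sort` thus finds
the exact place in a nested chain of semidecidable conditions, or reports that all of them hold.

Sorting from projection: fix an integer `b > 3 + ε`, and project the origin onto the closure of the
points `b⁻ⁱ • e₀` with `i` at most the number of zeros. Positive information on this set can be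
enumerated while zeros are being counted. Since `b > 1 + ε`, an approximate projection cannot stop
at a farther point when a nearer one exists (`norm_approxProj_scaleClosed`), so its norm is `b⁻ᵐ`
for exactly `m` zeros and `0` for infinitely many. A sufficiently good rational approximation
decodes it (`exists_name_sortFun`).

Projection from sorting: take levels decreasing geometrically with ratio `N / (N + 1)`, where `(N +
1) / N ≤ 1 + ε`. Positive information semidecides `d(x, A) < level`, so a machine can write one zero
for each level passed (`exists_name_dist_levels`). If sorting returns exactly `m` zeros, then `level
(m + 1) ≤ d(x, A) < level m`, and every point of `A` within `level m` of `x` is an admissible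
answer; one is found by following small balls that meet `A` (`exists_name_of_level_le`). If sorting
returns only zeros, then `x ∈ A` and `x` is the answer (`exists_name_of_infDist_eq_zero`). The final
machine cannot know in advance which case holds: while it sees zeros it copies approximations of
`x`, but only at a precision for which the levels already passed guarantee a nearby point of `A`, so
that it can later switch without revising output.

Computability is reduced to primitive recursiveness of a one-step function, whose tests compare
rational numbers. -/

theorem initialWord_succ (p : ℕ → ℕ) (k : ℕ) :
    initialWord p (k + 1) = initialWord p k ++ [p k] := by
  rw [initialWord, List.ofFn_succ_last]
  rfl

@[simp] theorem initialWord_zero (p : ℕ → ℕ) : initialWord p 0 = [] := by simp [initialWord]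

@[simp] theorem length_initialWord (p : ℕ → ℕ) (k : ℕ) : (initialWord p k).length = k := by
  simp [initialWord]

theorem getD_initialWord (p : ℕ → ℕ) {i k : ℕ} (h : i < k) : (initialWord p k).getD i 0 = p i := by
  simp [initialWord, List.getD, h]

theorem initialWord_ext {p : ℕ → ℕ} {k : ℕ} {l : List ℕ} (hl : l.length = k)
    (h : ∀ i < k, l.getD i 0 = p i) : l = initialWord p k := by
  refine List.ext_getElem (by simp [hl]) fun i h1 h2 => ?_
  have h3 := h i (hl ▸ h1)
  rw [List.getD_eq_getElem _ _ h1] at h3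
  simp [initialWord, h3]

/-- Run the machine `ψ` on a word: after each input symbol, `ψ` sees the input read so far and the
output written so far, and may append one output symbol. -/
def run (ψ : List ℕ → List ℕ → Option ℕ) (w : List ℕ) : List ℕ :=
  (w.foldl (fun s a => (s.1 ++ [a], s.2 ++ (ψ (s.1 ++ [a]) s.2).toList))
    (([], []) : List ℕ × List ℕ)).2

section Machine

variable {ψ : List ℕ → List ℕ → Option ℕ}

@[simp] theorem run_nil : run ψ [] = [] := rfl

theorem run_concat (w : List ℕ) (a : ℕ) :
    run ψ (w ++ [a]) = run ψ w ++ (ψ (w ++ [a]) (run ψ w)).toList := by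
  have h : ∀ w : List ℕ, (w.foldl (fun s a => (s.1 ++ [a], s.2 ++ (ψ (s.1 ++ [a]) s.2).toList))
      (([], []) : List ℕ × List ℕ)).1 = w := fun w => by
    induction w using List.reverseRecOn with
    | nil => rfl
    | append_singleton w a ih => rw [List.foldl_append, List.foldl_cons, List.foldl_nil, ih]
  simp only [run, List.foldl_append, List.foldl_cons, List.foldl_nil, h]

theorem run_mono {u v : List ℕ} (h : u <+: v) : run ψ u <+: run ψ v := by
  obtain ⟨t, rfl⟩ := h
  induction t using List.reverseRecOn with
  | nil => simp
  | append_singleton t a ih =>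
    rw [← List.append_assoc, run_concat]
    exact ih.trans (List.prefix_append _ _)

theorem primrec_run (hψ : Primrec₂ ψ) : Primrec (run ψ) := by
  have hw : Primrec fun x : List ℕ × (List ℕ × List ℕ) × ℕ => x.2.1.1 ++ [x.2.2] :=
    Primrec.list_concat.comp (Primrec.fst.comp (Primrec.fst.comp Primrec.snd))
      (Primrec.snd.comp Primrec.snd)
  have ho : Primrec fun x : List ℕ × (List ℕ × List ℕ) × ℕ => x.2.1.2 :=
    Primrec.snd.comp (Primrec.fst.comp Primrec.snd)
  exact Primrec.snd.comp (Primrec.list_foldl Primrec.id (Primrec.const ([], []))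
    (Primrec.pair hw (Primrec.list_append.comp ho
      (Primrec.optionToList.comp (hψ.comp hw ho)))).to₂)

theorem run_initialWord_succ (p : ℕ → ℕ) (k : ℕ) :
    run ψ (initialWord p (k + 1)) = run ψ (initialWord p k) ++
      (ψ (initialWord p (k + 1)) (run ψ (initialWord p k))).toList := by
  rw [initialWord_succ, run_concat]

theorem initialWord_prefix (p : ℕ → ℕ) {k l : ℕ} (h : k ≤ l) :
    initialWord p k <+: initialWord p l := by
  induction l, h using Nat.le_induction with
  | base => exact List.prefix_rfl
  | succ l _ ih => rw [initialWord_succ]; exact ih.trans (List.prefix_append _ _)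

theorem length_run_le (p : ℕ → ℕ) (k : ℕ) : (run ψ (initialWord p k)).length ≤ k := by
  induction k with
  | zero => simp
  | succ k ih =>
    rw [run_initialWord_succ, List.length_append]
    have : (ψ (initialWord p (k + 1)) (run ψ (initialWord p k))).toList.length ≤ 1 := by
      cases ψ (initialWord p (k + 1)) (run ψ (initialWord p k)) <;> simp
    omega

variable (ψ) in
/-- On input `p`, the machine `ψ` writes the infinite sequence `q`. -/
def Outputs (p q : ℕ → ℕ) : Prop :=
  (∀ k, ∃ m, run ψ (initialWord p k) = initialWord q m) ∧
    ∀ m, ∃ k, m ≤ (run ψ (initialWord p k)).length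

theorem Outputs.unique {p q q' : ℕ → ℕ} (h : Outputs ψ p q) (h' : Outputs ψ p q') : q = q' := by
  funext i
  obtain ⟨k, hk⟩ := h.2 (i + 1)
  obtain ⟨m, hm⟩ := h.1 k
  obtain ⟨m', hm'⟩ := h'.1 k
  have h1 : i < m := by rw [hm, length_initialWord] at hk; exact hk
  have h2 : i < m' := by rw [hm', length_initialWord] at hk; exact hk
  rw [← getD_initialWord q h1, ← hm, hm', getD_initialWord q' h2]

variable (ψ) in
/-- The partial function on Baire space computed by the machine `ψ`. -/
noncomputable def machineFun : (ℕ → ℕ) →. (ℕ → ℕ) :=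
  fun p => ⟨∃ q, Outputs ψ p q, fun h => h.choose⟩

theorem mem_machineFun {p q : ℕ → ℕ} : q ∈ machineFun ψ p ↔ Outputs ψ p q :=
  ⟨fun ⟨h, hq⟩ => hq ▸ h.choose_spec, fun h => ⟨⟨q, h⟩, Outputs.unique (Exists.choose_spec _) h⟩⟩

theorem typeTwoComputable_machineFun (hψ : Primrec₂ ψ) : TypeTwoComputable (machineFun ψ) :=
  ⟨run ψ, (primrec_run hψ).to_comp, fun _ _ h => run_mono h, fun _ _ h => mem_machineFun.1 h⟩

theorem exists_outputs {p : ℕ → ℕ} (h : ∀ m, ∃ k, m ≤ (run ψ (initialWord p k)).length) :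
    ∃ q, Outputs ψ p q := by
  choose f hf using h
  refine ⟨fun i => (run ψ (initialWord p (f (i + 1)))).getD i 0,
    fun k => ⟨_, initialWord_ext rfl fun i hi => ?_⟩, fun m => ⟨f m, hf m⟩⟩
  have h1 : i < (run ψ (initialWord p (f (i + 1)))).length := hf (i + 1)
  rw [List.getD_eq_getElem _ _ hi, List.getD_eq_getElem _ _ h1]
  rcases le_total k (f (i + 1)) with h | h
  · exact (run_mono (ψ := ψ) (initialWord_prefix p h)).getElem hi
  · exact ((run_mono (ψ := ψ) (initialWord_prefix p h)).getElem h1).symm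

/-- At most one symbol is written per step, so just before the output first exceeds length `i` it
has length exactly `i`. Properties of a single step thereby become properties of each `q i`. -/
theorem Outputs.exists_step {p q : ℕ → ℕ} (h : Outputs ψ p q) (i : ℕ) :
    ∃ k, run ψ (initialWord p k) = initialWord q i ∧
      ψ (initialWord p (k + 1)) (initialWord q i) = some (q i) := by
  classical
  have hex := h.2 (i + 1)
  have h1 := Nat.find_spec hex
  obtain ⟨k, hk⟩ : ∃ k, Nat.find hex = k + 1 := Nat.exists_eq_succ_of_ne_zero fun h0 => by
    rw [h0] at h1; simp at h1
  have h2 : ¬ i + 1 ≤ (run ψ (initialWord p k)).length := Nat.find_min hex (by omega)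
  rw [hk] at h1
  obtain ⟨m, hm⟩ := h.1 k
  obtain ⟨m', hm'⟩ := h.1 (k + 1)
  have h3 := run_initialWord_succ (ψ := ψ) p k
  have h4 := h3
  rw [hm'] at h1 h4
  rw [hm] at h2 h3 h4
  cases ho : ψ (initialWord p (k + 1)) (initialWord q m) with
  | none =>
    rw [ho] at h4
    have := congrArg List.length h4
    simp at this h1 h2
    omega
  | some a =>
    rw [ho] at h4
    have h5 := congrArg List.length h4
    simp at h5 h1 h2
    obtain rfl : m = i := by omega
    subst h5
    rw [initialWord_succ] at h4
    simp at h4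
    exact ⟨k, hm, by rw [ho, h4]⟩

/-- If an invariant of the output guarantees that further output will eventually be written, then
the machine produces an infinite sequence. -/
theorem exists_mem_machineFun {p : ℕ → ℕ} (Inv : List ℕ → Prop) (h0 : Inv [])
    (hstep : ∀ k out a, Inv out → ψ (initialWord p (k + 1)) out = some a → Inv (out ++ [a]))
    (hlive : ∀ k out, Inv out → ∃ l, k ≤ l ∧ (ψ (initialWord p (l + 1)) out).isSome) :
    ∃ q ∈ machineFun ψ p, ∀ i, Inv (initialWord q i) ∧
      ∃ k, i ≤ k ∧ ψ (initialWord p (k + 1)) (initialWord q i) = some (q i) := by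
  have hInv : ∀ k, Inv (run ψ (initialWord p k)) := fun k => by
    induction k with
    | zero => simpa using h0
    | succ k ih =>
      rw [run_initialWord_succ]
      cases ho : ψ (initialWord p (k + 1)) (run ψ (initialWord p k)) with
      | none => simpa using ih
      | some a => simpa using hstep k _ a ih ho
  have hunb : ∀ m, ∃ k, m ≤ (run ψ (initialWord p k)).length := fun m => by
    induction m with
    | zero => exact ⟨0, Nat.zero_le _⟩
    | succ m ih =>
      obtain ⟨k, hk⟩ := ih
      -- Liveness speaks of the output at time `k`. By time `l` the output has either grown already
      -- or is still that same word, and then step `l + 1` writes.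
      obtain ⟨l, hl, hs⟩ := hlive k _ (hInv k)
      have hpre := run_mono (ψ := ψ) (initialWord_prefix p hl)
      by_cases heq : (run ψ (initialWord p l)).length = (run ψ (initialWord p k)).length
      · rw [hpre.eq_of_length heq.symm] at hs
        obtain ⟨a, ha⟩ := Option.isSome_iff_exists.1 hs
        refine ⟨l + 1, ?_⟩
        rw [run_initialWord_succ, ha]
        simp [heq, hk]
      · exact ⟨l, by have := hpre.length_le; omega⟩
  obtain ⟨q, hq⟩ := exists_outputs hunb
  refine ⟨q, mem_machineFun.2 hq, fun i => ?_⟩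
  obtain ⟨k, hk1, hk2⟩ := hq.exists_step i
  refine ⟨hk1 ▸ hInv k, k, ?_, hk2⟩
  simpa [hk1] using length_run_le (ψ := ψ) p k

/-- A machine that writes a symbol at every step. -/
theorem exists_mem_machineFun_of_total {g : List ℕ → List ℕ → ℕ} (p : ℕ → ℕ) :
    ∃ q ∈ machineFun (fun w out => some (g w out)) p,
      ∀ i, q i = g (initialWord p (i + 1)) (initialWord q i) := by
  have hlen : ∀ k, (run (fun w out => some (g w out)) (initialWord p k)).length = k := fun k => by
    induction k with
    | zero => simp
    | succ k ih => rw [run_initialWord_succ]; simp [ih]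
  obtain ⟨q, hq⟩ := exists_outputs fun m => ⟨m, (hlen m).ge⟩
  refine ⟨q, mem_machineFun.2 hq, fun i => ?_⟩
  obtain ⟨k, hk1, hk2⟩ := hq.exists_step i
  obtain rfl : k = i := by rw [← hlen k, hk1, length_initialWord]
  exact (Option.some.inj hk2).symm

end Machine

/-! ### Primitive recursive rational-valued functions -/

section PrimrecRat

variable {α β : Type*} [Primcodable α] [Primcodable β]

/-- A rational-valued function is primitive recursive if it has the form `(a - b) / (c + 1)` with
primitive recursive `a`, `b`, `c`. -/
def PrimrecRat (f : α → ℚ) : Prop :=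
  ∃ a b c : α → ℕ, Primrec a ∧ Primrec b ∧ Primrec c ∧
    ∀ x, f x = ((a x : ℚ) - b x) / ((c x : ℚ) + 1)

namespace PrimrecRat

variable {f g : α → ℚ}

theorem comp {f : β → ℚ} (hf : PrimrecRat f) {e : α → β} (he : Primrec e) :
    PrimrecRat fun x => f (e x) := by
  obtain ⟨a, b, c, ha, hb, hc, h⟩ := hf
  exact ⟨_, _, _, ha.comp he, hb.comp he, hc.comp he, fun x => h (e x)⟩

theorem const (q : ℚ) : PrimrecRat fun _ : α => q := by
  obtain ⟨k, hk⟩ := ratEnum_surjective q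
  exact ⟨_, _, _, Primrec.const _, Primrec.const _, Primrec.const _, fun _ => hk.symm⟩

theorem ratEnum : PrimrecRat ratEnum :=
  have h := Primrec.unpair.comp (Primrec.fst.comp Primrec.unpair)
  ⟨_, _, _, Primrec.fst.comp h, Primrec.snd.comp h, Primrec.snd.comp Primrec.unpair, fun _ => rfl⟩

theorem nonnegRatEnum : PrimrecRat nonnegRatEnum :=
  ⟨_, _, _, Primrec.fst.comp Primrec.unpair, Primrec.const 0, Primrec.snd.comp Primrec.unpair,
    fun _ => by simp [_root_.nonnegRatEnum]⟩

theorem neg (hf : PrimrecRat f) : PrimrecRat fun x => -f x := by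
  obtain ⟨a, b, c, ha, hb, hc, h⟩ := hf
  exact ⟨b, a, c, hb, ha, hc, fun x => by
    beta_reduce
    rw [h, ← neg_div, neg_sub]⟩

theorem add (hf : PrimrecRat f) (hg : PrimrecRat g) : PrimrecRat fun x => f x + g x := by
  obtain ⟨a, b, c, ha, hb, hc, h⟩ := hf
  obtain ⟨a', b', c', ha', hb', hc', h'⟩ := hg
  have hs := Primrec.succ.comp hc
  have hs' := Primrec.succ.comp hc'
  refine ⟨fun x => a x * (c' x).succ + a' x * (c x).succ,
    fun x => b x * (c' x).succ + b' x * (c x).succ, fun x => c x * (c' x).succ + c' x,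
    Primrec.nat_add.comp (Primrec.nat_mul.comp ha hs') (Primrec.nat_mul.comp ha' hs),
    Primrec.nat_add.comp (Primrec.nat_mul.comp hb hs') (Primrec.nat_mul.comp hb' hs),
    Primrec.nat_add.comp (Primrec.nat_mul.comp hc hs') hc', fun x => ?_⟩
  have h1 : (c x : ℚ) + 1 ≠ 0 := by positivity
  have h2 : (c' x : ℚ) + 1 ≠ 0 := by positivity
  have h3 : (((c x * (c' x).succ + c' x : ℕ) : ℚ) + 1) = (c x + 1) * (c' x + 1) := by
    push_cast; ring
  beta_reduce
  rw [h, h', h3]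
  push_cast
  field_simp
  ring

theorem mul (hf : PrimrecRat f) (hg : PrimrecRat g) : PrimrecRat fun x => f x * g x := by
  obtain ⟨a, b, c, ha, hb, hc, h⟩ := hf
  obtain ⟨a', b', c', ha', hb', hc', h'⟩ := hg
  have hs' := Primrec.succ.comp hc'
  refine ⟨fun x => a x * a' x + b x * b' x,
    fun x => a x * b' x + b x * a' x, fun x => c x * (c' x).succ + c' x,
    Primrec.nat_add.comp (Primrec.nat_mul.comp ha ha') (Primrec.nat_mul.comp hb hb'),
    Primrec.nat_add.comp (Primrec.nat_mul.comp ha hb') (Primrec.nat_mul.comp hb ha'),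
    Primrec.nat_add.comp (Primrec.nat_mul.comp hc hs') hc', fun x => ?_⟩
  have h3 : (((c x * (c' x).succ + c' x : ℕ) : ℚ) + 1) = (c x + 1) * (c' x + 1) := by
    push_cast; ring
  beta_reduce
  rw [h, h', h3, div_mul_div_comm]
  push_cast
  ring

theorem sub (hf : PrimrecRat f) (hg : PrimrecRat g) : PrimrecRat fun x => f x - g x := by
  simpa only [sub_eq_add_neg] using hf.add hg.neg

theorem sq (hf : PrimrecRat f) : PrimrecRat fun x => f x ^ 2 := by
  simpa only [_root_.sq] using hf.mul hf

/-- Powers of a fixed nonnegative rational number. -/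
theorem pow {r : ℚ} (hr : 0 ≤ r) {e : α → ℕ} (he : Primrec e) :
    PrimrecRat fun x => r ^ e x := by
  have hpow : ∀ d : ℕ, Primrec fun x => d ^ e x := fun d =>
    (Primrec₂.unpaired'.1 Nat.Primrec.pow).comp (Primrec.const d) he
  refine ⟨fun x => r.num.toNat ^ e x, fun _ => 0, fun x => r.den ^ e x - 1, hpow _,
    Primrec.const 0, Primrec.nat_sub.comp (hpow _) (Primrec.const 1), fun x => ?_⟩
  have h1 : ((r.den ^ e x - 1 : ℕ) : ℚ) + 1 = (r.den : ℚ) ^ e x := by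
    exact_mod_cast Nat.sub_add_cancel (Nat.one_le_pow _ _ r.pos)
  have h2 : ((r.num.toNat : ℕ) : ℚ) = (r.num : ℚ) := by
    exact_mod_cast congrArg (Int.cast : ℤ → ℚ) (Int.toNat_of_nonneg (Rat.num_nonneg.2 hr))
  rw [h1]
  push_cast
  rw [h2, sub_zero, ← div_pow, Rat.num_div_den]

theorem lt (hf : PrimrecRat f) (hg : PrimrecRat g) : PrimrecPred fun x => f x < g x := by
  obtain ⟨a, b, c, ha, hb, hc, h⟩ := hf
  obtain ⟨a', b', c', ha', hb', hc', h'⟩ := hg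
  have hs := Primrec.succ.comp hc
  have hs' := Primrec.succ.comp hc'
  refine (Primrec.nat_lt.comp
    (Primrec.nat_add.comp (Primrec.nat_mul.comp ha hs') (Primrec.nat_mul.comp hb' hs))
    (Primrec.nat_add.comp (Primrec.nat_mul.comp ha' hs) (Primrec.nat_mul.comp hb hs'))).of_eq
    fun x => ?_
  have h1 : (0 : ℚ) < (c x : ℚ) + 1 := by positivity
  have h2 : (0 : ℚ) < (c' x : ℚ) + 1 := by positivity
  rw [h, h', div_lt_div_iff₀ h1 h2, ← Nat.cast_lt (α := ℚ)]
  push_cast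
  constructor <;> intro h <;> linarith

end PrimrecRat

end PrimrecRat

/-! ### Distances between rational points -/

/-- The squared Euclidean distance of two rational points. -/
def sqDist (n k l : ℕ) : ℚ :=
  ∑ i ∈ Finset.range n, (ratEnum (codeEntry k i) - ratEnum (codeEntry l i)) ^ 2

theorem dist_ratPoint (n k l : ℕ) :
    dist (ratPoint n k) (ratPoint n l) = √(sqDist n k l : ℝ) := by
  rw [EuclideanSpace.dist_eq, sqDist, Finset.sum_range]
  push_cast
  simp [ratPoint, Real.dist_eq, sq_abs]

theorem sqDist_nonneg (n k l : ℕ) : 0 ≤ sqDist n k l :=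
  Finset.sum_nonneg fun _ _ => sq_nonneg _

/-- A decidable form of `dist (ratPoint n k) (ratPoint n l) < v`. -/
def RatDistLt (n k l : ℕ) (v : ℚ) : Prop := 0 < v ∧ sqDist n k l < v ^ 2

/-- Squaring removes the irrational root. The conjunct `0 < v` cannot be dropped, because `v` is
later a difference that may be negative. -/
theorem ratDistLt_iff {n k l : ℕ} {v : ℚ} :
    RatDistLt n k l v ↔ dist (ratPoint n k) (ratPoint n l) < v := by
  rw [dist_ratPoint, RatDistLt]
  constructor
  · rintro ⟨h1, h2⟩
    rw [Real.sqrt_lt' (by exact_mod_cast h1)]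
    exact_mod_cast h2
  · intro h
    have h1 : (0 : ℝ) < v := (Real.sqrt_nonneg _).trans_lt h
    rw [Real.sqrt_lt' h1] at h
    exact ⟨by exact_mod_cast h1, by exact_mod_cast h⟩

theorem isOpen_basicBall {X : Type*} [MetricSpace X] (α : ℕ → X) (k : ℕ) :
    IsOpen (basicBall α k) :=
  isOpen_ball

theorem mem_basicBall_ratPoint {n k b : ℕ} : ratPoint n k ∈ basicBall (ratPoint n) b ↔
    RatDistLt n k b.unpair.1 (nonnegRatEnum b.unpair.2) := by
  rw [ratDistLt_iff, basicBall, mem_ball]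

theorem primrec_codeEntry (i : ℕ) : Primrec fun k => codeEntry k i :=
  Primrec.fst.comp (Primrec.unpair.comp (Primrec.nat_iterate (Primrec.const i) Primrec.id
    (Primrec.snd.comp (Primrec.unpair.comp Primrec.snd)).to₂))

section

variable {α : Type*} [Primcodable α]

theorem primrecRat_sqDist (n : ℕ) {k l : α → ℕ} (hk : Primrec k) (hl : Primrec l) :
    PrimrecRat fun x => sqDist n (k x) (l x) := by
  simp only [sqDist]
  induction n with
  | zero => simpa using PrimrecRat.const 0
  | succ n ih =>
    simp only [Finset.sum_range_succ]
    exact ih.add ((PrimrecRat.ratEnum.comp ((primrec_codeEntry n).comp hk)).sub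
      (PrimrecRat.ratEnum.comp ((primrec_codeEntry n).comp hl))).sq

theorem primrecPred_ratDistLt (n : ℕ) {k l : α → ℕ} {v : α → ℚ} (hk : Primrec k) (hl : Primrec l)
    (hv : PrimrecRat v) : PrimrecPred fun x => RatDistLt n (k x) (l x) (v x) :=
  ((PrimrecRat.const 0).lt hv).and ((primrecRat_sqDist n hk hl).lt hv.sq)

end

theorem nonnegRatEnum_nonneg (m : ℕ) : 0 ≤ nonnegRatEnum m := by
  unfold nonnegRatEnum
  positivity

theorem exists_mem_basicBall_radius_lt {X : Type*} [MetricSpace X] {α : ℕ → X}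
    (hα : DenseRange α) (x : X) {r : ℝ} (hr : 0 < r) :
    ∃ k, x ∈ basicBall α k ∧ (nonnegRatEnum k.unpair.2 : ℝ) < r := by
  obtain ⟨n, hn⟩ := hα.exists_dist_lt x hr
  obtain ⟨q, hq1, hq2⟩ := exists_rat_btwn hn
  obtain ⟨m, hm⟩ := exists_nonnegRatEnum_eq (q := q) (by exact_mod_cast dist_nonneg.trans hq1.le)
  exact ⟨Nat.pair n m, by simpa [basicBall, hm] using hq1, by simpa [hm] using hq2⟩

theorem dist_le_of_cauchyRep {X : Type*} [MetricSpace X] {α : ℕ → X} {hα : DenseRange α}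
    {p : ℕ → ℕ} {x : X} (h : (cauchyRep α hα).IsName p x) (i : ℕ) :
    dist (α (p i)) x ≤ (1 / 2) ^ i :=
  le_of_tendsto (tendsto_const_nhds.dist h.2)
    (eventually_atTop.2 ⟨i, fun j hj => h.1 i j hj⟩)

/-! ### Counting zeros and sorting -/

/-- The number of occurrences of `0` in a word. -/
def zeroCount (w : List ℕ) : ℕ := (w.filter (· = 0)).length

theorem primrec_zeroCount : Primrec zeroCount :=
  Primrec.list_length.comp (Primrec.listFilter (Primrec.eq.comp Primrec.id (Primrec.const 0)))

theorem zeroCount_initialWord (p : ℕ → ℕ) (k : ℕ) :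
    zeroCount (initialWord p k) = Nat.count (fun i => p i = 0) k := by
  induction k with
  | zero => simp [zeroCount]
  | succ k ih =>
    rw [initialWord_succ, Nat.count_succ, ← ih]
    by_cases h : p k = 0 <;> simp [zeroCount, h]

/-- Finitely and infinitely many zeros are treated uniformly here, as the condition on the right is
existential in time. -/
theorem sortFun_eq_zero_iff {p : ℕ → ℕ} {x : ℕ → Fin 2} (hp : cantorRep.IsName p x) (j : ℕ) :
    sortFun x j = 0 ↔ ∃ k, j < Nat.count (fun i => p i = 0) k := by
  have hset : {i | x i = 0} = {i | p i = 0} := by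
    ext i
    have := hp i
    simp only [Set.mem_ofPred_eq, Fin.ext_iff, Fin.val_zero]
    omega
  have hnth : (∀ hf : {i | p i = 0}.Finite, j < hf.toFinset.card) →
      ∃ k, j < Nat.count (fun i => p i = 0) k := fun h =>
    ⟨_, by rw [Nat.count_nth_succ h]; exact Nat.lt_succ_self j⟩
  unfold sortFun
  rw [hset]
  split_ifs with hfin
  · rw [Set.ncard_eq_toFinset_card _ hfin]
    by_cases hj : j < hfin.toFinset.card
    · simpa only [hj, if_true, true_iff] using hnth fun _ => hj
    · simp only [hj, if_false, one_ne_zero, false_iff, not_exists, not_lt]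
      intro k
      refine le_trans ?_ (not_lt.1 hj)
      rw [Nat.count_eq_card_filter_range]
      exact Finset.card_le_card fun i hi => by simpa using (Finset.mem_filter.1 hi).2
  · simpa using hnth fun h => absurd h hfin

/-! ### Reducing sorting to approximate projection -/

/-- A code of the rational point `b⁻ⁱ • e₀`. -/
def scalePoint (b i : ℕ) : ℕ := Nat.pair (Nat.pair (Nat.pair 1 0) (b ^ i - 1)) 0

theorem primrec_scalePoint (b : ℕ) : Primrec (scalePoint b) :=
  Primrec₂.natPair.comp (Primrec₂.natPair.comp (Primrec.const _)
    (Primrec.nat_sub.comp ((Primrec₂.unpaired'.1 Nat.Primrec.pow).comp (Primrec.const b) Primrec.id)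
      (Primrec.const 1))) (Primrec.const 0)

theorem codeEntry_zero_left (i : ℕ) : codeEntry 0 i = 0 := by
  have h : (fun m => (Nat.unpair m).2)^[i] 0 = 0 := Function.iterate_fixed (by simp) i
  simp [codeEntry, h]

theorem ratPoint_zero (n : ℕ) : ratPoint n 0 = 0 := by
  ext i
  simp [ratPoint, codeEntry_zero_left, ratEnum]

theorem dist_scalePoint {n : ℕ} (hn : 1 ≤ n) {b : ℕ} (hb : 0 < b) (i : ℕ) :
    dist (ratPoint n (scalePoint b i)) 0 = (1 / b : ℝ) ^ i := by
  have h0 : ratEnum (codeEntry (scalePoint b i) 0) = (1 / b : ℚ) ^ i := by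
    have : ((b ^ i - 1 : ℕ) : ℚ) + 1 = (b : ℚ) ^ i := by
      exact_mod_cast Nat.sub_add_cancel (Nat.one_le_pow i b hb)
    simp [codeEntry, scalePoint, ratEnum, this]
  have hs : ∀ j, codeEntry (scalePoint b i) (j + 1) = 0 := fun j => by
    have := codeEntry_zero_left j
    simpa [codeEntry, scalePoint] using this
  have : ratPoint n (scalePoint b i) =
      EuclideanSpace.single (⟨0, hn⟩ : Fin n) ((1 / b : ℝ) ^ i) := by
    ext ⟨j, hj⟩
    cases j with
    | zero => simp [ratPoint, h0]
    | succ j => simp [ratPoint, hs, ratEnum]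
  rw [this, dist_zero_right, PiLp.norm_single, Real.norm_of_nonneg (by positivity)]

section SortToProj

variable (n b : ℕ)

/-- The code of the ball with centre `e₀` and radius `1`. -/
def defaultBall : ℕ := Nat.pair (scalePoint b 0) (Nat.pair 1 0)

open Classical in
/-- The symbol written at time `k` by the machine that turns a point of Cantor space into a name of
the origin and the closed set of all `b⁻ⁱ • e₀`, `i` at most the number of zeros. -/
noncomputable def scaleSetStep (w : List ℕ) : ℕ :=
  Nat.pair 0 (if (w.length - 1).unpair.2.unpair.1 ≤ zeroCount w ∧
    RatDistLt n (scalePoint b (w.length - 1).unpair.2.unpair.1)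
      (w.length - 1).unpair.1.unpair.1 (nonnegRatEnum (w.length - 1).unpair.1.unpair.2)
    then (w.length - 1).unpair.1 else defaultBall b)

theorem primrec_scaleSetStep : Primrec (scaleSetStep n b) := by
  classical
  have hk : Primrec fun w : List ℕ => (w.length - 1).unpair :=
    Primrec.unpair.comp (Primrec.nat_sub.comp Primrec.list_length (Primrec.const 1))
  have hc := Primrec.fst.comp hk
  have hcu := Primrec.unpair.comp hc
  have hi := Primrec.fst.comp (Primrec.unpair.comp (Primrec.snd.comp hk))
  exact Primrec₂.natPair.comp (Primrec.const 0) (Primrec.ite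
    ((Primrec.nat_le.comp hi primrec_zeroCount).and
      (primrecPred_ratDistLt n ((primrec_scalePoint b).comp hi) (Primrec.fst.comp hcu)
        (PrimrecRat.nonnegRatEnum.comp (Primrec.snd.comp hcu)))) hc (Primrec.const _))

open Classical in
/-- The machine recovering the sorted sequence from a name of a point of norm `b⁻ᵐ` or `0`. -/
noncomputable def scaleReadStep (w out : List ℕ) : Option ℕ :=
  if b * (out.length + 1) < w.length then
    some (if RatDistLt n (w.getD (b * (out.length + 1)) 0).unpair.2 0
      (2 * (1 / b : ℚ) ^ (out.length + 1)) then 0 else 1)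
  else none

theorem primrec_scaleReadStep : Primrec₂ (scaleReadStep n b) := by
  classical
  have hl : Primrec fun x : List ℕ × List ℕ => x.2.length + 1 :=
    Primrec.succ.comp (Primrec.list_length.comp Primrec.snd)
  have hN := Primrec.nat_mul.comp (Primrec.const b) hl
  exact Primrec.ite (Primrec.nat_lt.comp hN (Primrec.list_length.comp Primrec.fst))
    (Primrec.option_some.comp (Primrec.ite (primrecPred_ratDistLt n
      (Primrec.snd.comp (Primrec.unpair.comp ((Primrec.list_getD 0).comp Primrec.fst hN)))
      (Primrec.const 0) ((PrimrecRat.const 2).mul (PrimrecRat.pow (by positivity) hl)))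
      (Primrec.const 0) (Primrec.const 1))) (Primrec.const none)

/-- The points `b⁻ⁱ • e₀`, `i` at most the number of zeros of `p`. -/
def scaleSet (p : ℕ → ℕ) : Set (EuclideanSpace ℝ (Fin n)) :=
  {a | ∃ i k, i ≤ Nat.count (fun j => p j = 0) k ∧ a = ratPoint n (scalePoint b i)}

variable {n b} in
theorem mem_scaleSet {p : ℕ → ℕ} {i k : ℕ} (h : i ≤ Nat.count (fun j => p j = 0) k) :
    ratPoint n (scalePoint b i) ∈ scaleSet n b p :=
  ⟨i, k, h, rfl⟩

/-- The closure of `scaleSet`. -/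
def scaleClosed (p : ℕ → ℕ) : NonemptyClosed (EuclideanSpace ℝ (Fin n)) :=
  ⟨closure (scaleSet n b p), isClosed_closure,
    ⟨_, subset_closure (mem_scaleSet (k := 0) (Nat.zero_le _))⟩⟩

variable {n b}

/-- An open ball meets the closure iff it meets the set itself, so testing the points `b⁻ⁱ • e₀`
suffices. Failed tests emit the default ball, which contains the ever-present point `e₀`. -/
theorem exists_name_scaleClosed (p : ℕ → ℕ) :
    ∃ r ∈ machineFun (fun w _ => some (scaleSetStep n b w)) p,
      ((euclideanRep n).prod (euclideanClosedRep n)).IsName r (0, scaleClosed n b p) := by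
  obtain ⟨r, hr, hstep⟩ := exists_mem_machineFun_of_total (g := fun w _ => scaleSetStep n b w) p
  refine ⟨r, hr, fun _ => 0, fun i => (r i).unpair.2, ?_, ?_, ?_⟩
  · funext i
    have h0 : (r i).unpair.1 = 0 := by rw [hstep, scaleSetStep, Nat.unpair_pair]
    exact (Nat.pair_unpair (r i)).symm.trans (by rw [h0]; rfl)
  · constructor
    · intro i j _
      simp
    · simp [ratPoint_zero]
  · intro c
    rw [show (scaleClosed n b p).1 = closure (scaleSet n b p) from rfl,
      Set.inter_comm, closure_inter_open_nonempty_iff (isOpen_basicBall _ _)]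
    constructor
    · rintro ⟨t, rfl⟩
      beta_reduce
      rw [hstep, scaleSetStep]
      rw [length_initialWord, Nat.add_sub_cancel, zeroCount_initialWord, Nat.unpair_pair]
      split_ifs with h
      · have h1 := mem_scaleSet (n := n) (b := b) h.1
        have h2 := mem_basicBall_ratPoint.2 h.2
        exact ⟨_, h1, h2⟩
      · refine ⟨_, mem_scaleSet (i := 0) (k := 0) (Nat.zero_le _), ?_⟩
        simp [defaultBall, basicBall, nonnegRatEnum]
    · rintro ⟨_, ⟨i, k, hik, rfl⟩, hc⟩
      refine ⟨Nat.pair c (Nat.pair i k), ?_⟩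
      beta_reduce
      have hk : k ≤ Nat.pair c (Nat.pair i k) :=
        (Nat.right_le_pair i k).trans (Nat.right_le_pair _ _)
      rw [hstep, scaleSetStep]
      rw [length_initialWord, Nat.add_sub_cancel, zeroCount_initialWord, if_pos]
      · simp only [Nat.unpair_pair]
      · simp only [Nat.unpair_pair]
        exact ⟨hik.trans (Nat.count_monotone _ (by omega)), mem_basicBall_ratPoint.1 hc⟩

/-- No norm in the set lies strictly between `b⁻⁽ʲ⁺¹⁾` and `b⁻ʲ`, and the closure inherits this gap.
Once index `j + 1` is admitted, norm at least `b⁻ʲ` would force `b ≤ 1 + ε`. -/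
theorem norm_approxProj_scaleClosed (hn : 1 ≤ n) (hb : 1 ≤ b) {ε : ℝ} (hε : 0 < ε)
    (hbε : 1 + ε < b) {p : ℕ → ℕ} {y : EuclideanSpace ℝ (Fin n)}
    (hy : y ∈ approxProj ε (0, scaleClosed n b p)) (j : ℕ) :
    ((∃ k, j < Nat.count (fun i => p i = 0) k) → dist y 0 ≤ (1 / b : ℝ) ^ (j + 1)) ∧
      ((¬ ∃ k, j < Nat.count (fun i => p i = 0) k) → (1 / b : ℝ) ^ j ≤ dist y 0) := by
  obtain ⟨hyA, hyd⟩ := hy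
  have hb0 : (0 : ℝ) < b := by exact_mod_cast hb
  have hb1 : (1 / b : ℝ) ≤ 1 := by
    rw [div_le_one hb0]; exact_mod_cast hb
  have hpow : ∀ {i k : ℕ}, i ≤ k → (1 / b : ℝ) ^ k ≤ (1 / b : ℝ) ^ i := fun h =>
    pow_le_pow_of_le_one (by positivity) hb1 h
  have hdist : Continuous fun z : EuclideanSpace ℝ (Fin n) => dist z 0 :=
    continuous_id.dist continuous_const
  constructor
  · rintro ⟨k, hk⟩
    have hsub : closure (scaleSet n b p) ⊆
        {z | dist z 0 ≤ (1 / b : ℝ) ^ (j + 1)} ∪ {z | (1 / b : ℝ) ^ j ≤ dist z 0} := by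
      refine closure_minimal ?_ ((isClosed_le hdist continuous_const).union
        (isClosed_le continuous_const hdist))
      rintro _ ⟨i, -, -, rfl⟩
      simp only [Set.mem_union, Set.mem_ofPred_eq, dist_scalePoint hn hb]
      rcases Nat.lt_or_ge j i with h | h
      · exact Or.inl (hpow h)
      · exact Or.inr (hpow h)
    refine (hsub hyA).resolve_right fun h => ?_
    have h1 : infDist 0 (scaleClosed n b p).1 ≤ (1 / b : ℝ) ^ (j + 1) := by
      rw [← dist_scalePoint hn hb, dist_comm]
      exact infDist_le_dist_of_mem (subset_closure (mem_scaleSet hk))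
    have h2 : (1 / b : ℝ) ^ j ≤ (1 + ε) * (1 / b : ℝ) ^ (j + 1) :=
      (h.trans (dist_comm y 0 ▸ hyd)).trans (by gcongr)
    have h3 : (1 / b : ℝ) ^ j = b * (1 / b : ℝ) ^ (j + 1) := by
      rw [pow_succ]; field_simp
    rw [h3] at h2
    have := le_of_mul_le_mul_right h2 (by positivity)
    linarith
  · intro hk
    have hsub : closure (scaleSet n b p) ⊆ {z | (1 / b : ℝ) ^ j ≤ dist z 0} := by
      refine closure_minimal ?_ (isClosed_le continuous_const hdist)
      rintro _ ⟨i, k, hik, rfl⟩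
      simp only [Set.mem_ofPred_eq, dist_scalePoint hn hb]
      exact hpow (hik.trans (not_lt.1 fun h => hk ⟨k, h⟩))
    exact hsub hyA

/-- In units of `b⁻⁽ʲ⁺¹⁾` the norm is at most `1` or at least `b ≥ 3`; with an error below `1`, the
threshold `2` separates the cases. -/
theorem exists_name_sortFun (hb : 3 ≤ b) {p q : ℕ → ℕ} {x : ℕ → Fin 2}
    (hp : cantorRep.IsName p x) {y : EuclideanSpace ℝ (Fin n)} (hq : (euclideanRep n).IsName q y)
    (hy : ∀ j, ((∃ k, j < Nat.count (fun i => p i = 0) k) → dist y 0 ≤ (1 / b : ℝ) ^ (j + 1)) ∧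
      ((¬ ∃ k, j < Nat.count (fun i => p i = 0) k) → (1 / b : ℝ) ^ j ≤ dist y 0)) :
    ∃ s ∈ machineFun (scaleReadStep n b) (pairName p q), cantorRep.IsName s (sortFun x) := by
  obtain ⟨s, hs, hstep⟩ := exists_mem_machineFun (ψ := scaleReadStep n b) (p := pairName p q)
    (fun _ => True) trivial (fun _ _ _ _ _ => trivial) (fun k out _ =>
      ⟨k + b * (out.length + 1), by omega, by
        rw [scaleReadStep, if_pos (by rw [length_initialWord]; omega)]; rfl⟩)
  refine ⟨s, hs, fun j => ?_⟩
  obtain ⟨-, k, -, hk⟩ := hstep j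
  rw [scaleReadStep, length_initialWord, length_initialWord] at hk
  have h1 : b * (j + 1) < k + 1 := by
    by_contra h
    rw [if_neg h] at hk
    exact Option.some_ne_none _ hk.symm
  rw [if_pos h1, Option.some_inj, getD_initialWord _ h1, pairName, Nat.unpair_pair] at hk
  have hD := ratDistLt_iff (n := n) (k := q (b * (j + 1))) (l := 0)
    (v := 2 * (1 / b : ℚ) ^ (j + 1))
  rw [ratPoint_zero] at hD
  push_cast at hD
  rw [← hk]
  have hb0 : (0 : ℝ) < b := by exact_mod_cast (by omega : 0 < b)
  -- Reading at index `b * (j + 1)` gives error `(2⁻ᵇ)ʲ⁺¹`, and `b < 2ᵇ`.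
  have herr : dist (ratPoint n (q (b * (j + 1)))) y < (1 / b : ℝ) ^ (j + 1) := by
    refine (dist_le_of_cauchyRep hq _).trans_lt ?_
    rw [pow_mul]
    refine pow_lt_pow_left₀ ?_ (by positivity) (by omega)
    rw [one_div_pow]
    exact one_div_lt_one_div_of_lt hb0 (by exact_mod_cast Nat.lt_two_pow_self)
  have hiff := sortFun_eq_zero_iff hp j
  have h3 := dist_triangle (ratPoint n (q (b * (j + 1)))) y 0
  have h4 := dist_triangle_left y 0 (ratPoint n (q (b * (j + 1))))
  by_cases hz : ∃ k, j < Nat.count (fun i => p i = 0) k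
  · rw [hiff.2 hz, if_pos (hD.2 (by linarith [(hy j).1 hz]))]
    rfl
  · have hpow : (1 / b : ℝ) ^ j = b * (1 / b : ℝ) ^ (j + 1) := by
      rw [pow_succ]; field_simp
    have hge := (hy j).2 hz
    have h5 : (3 : ℝ) * (1 / b : ℝ) ^ (j + 1) ≤ b * (1 / b : ℝ) ^ (j + 1) := by
      gcongr; exact_mod_cast hb
    rw [if_neg fun h => by linarith [hD.1 h]]
    have := mt hiff.1 hz
    have h6 := (sortFun x j).isLt
    rw [Fin.ext_iff, Fin.val_zero] at this
    omega

theorem sort_reducible_approxProj {ε : ℝ} (hε : 0 < ε) (hn : 1 ≤ n) :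
    WeihrauchReducible cantorRep cantorRep (fun p : ℕ → Fin 2 => {sortFun p})
      ((euclideanRep n).prod (euclideanClosedRep n)) (euclideanRep n)
      (approxProj (X := EuclideanSpace ℝ (Fin n)) ε) := by
  obtain ⟨b, hb⟩ := exists_nat_gt (3 + ε)
  have hb3 : 3 ≤ b := by exact_mod_cast (by linarith : (3 : ℝ) ≤ b)
  refine ⟨machineFun (scaleReadStep n b), machineFun fun w _ => some (scaleSetStep n b w),
    typeTwoComputable_machineFun (primrec_scaleReadStep n b),
    typeTwoComputable_machineFun
      (Primrec.option_some.comp ((primrec_scaleSetStep n b).comp Primrec.fst)),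
    fun G hG p x hp _ => ?_⟩
  obtain ⟨r, hr, hrn⟩ := exists_name_scaleClosed (n := n) (b := b) p
  obtain ⟨q, hq, y, hy, hyn⟩ := hG r _ hrn (by
    obtain ⟨y, hy, hd⟩ := (scaleClosed n b p).2.1.exists_infDist_eq_dist
      (scaleClosed n b p).2.2 0
    refine ⟨y, hy, ?_⟩
    rw [← hd]
    exact le_mul_of_one_le_left infDist_nonneg (by linarith))
  obtain ⟨s, hs, hsn⟩ := exists_name_sortFun hb3 hp hyn
    (norm_approxProj_scaleClosed hn (by omega) hε (by linarith) hy)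
  exact ⟨s, Part.mem_bind hr (Part.mem_bind hq hs), _, rfl, hsn⟩

end SortToProj

/-! ### Reducing approximate projection to sorting -/

/-- If `a` names a point `x` up to `2⁻ᵏ`, then this decidable condition ensures that the ball with
index `b` lies within distance `v` of `x`. -/
def BallWithin (n a b k : ℕ) (v : ℚ) : Prop :=
  RatDistLt n a b.unpair.1 (v - nonnegRatEnum b.unpair.2 - (1 / 2) ^ k)

theorem ballWithin_iff {n a b k : ℕ} {v : ℚ} : BallWithin n a b k v ↔
    dist (ratPoint n a) (ratPoint n b.unpair.1) <
      (v : ℝ) - (nonnegRatEnum b.unpair.2 : ℝ) - (1 / 2) ^ k := by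
  rw [BallWithin, ratDistLt_iff]
  push_cast
  rfl

theorem BallWithin.dist_lt {n a b k : ℕ} {v : ℚ} (h : BallWithin n a b k v)
    {x y : EuclideanSpace ℝ (Fin n)} (hx : dist (ratPoint n a) x ≤ (1 / 2) ^ k)
    (hy : y ∈ basicBall (ratPoint n) b) : dist x y < v := by
  rw [ballWithin_iff] at h
  rw [basicBall, mem_ball] at hy
  have h1 := dist_triangle_left x y (ratPoint n a)
  have h2 := dist_triangle_right (ratPoint n a) y (ratPoint n b.unpair.1)
  linarith

theorem eventually_ballWithin {n b : ℕ} {p : ℕ → ℕ} {x : EuclideanSpace ℝ (Fin n)} {v : ℚ}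
    (hx : (euclideanRep n).IsName p x)
    (h : dist x (ratPoint n b.unpair.1) + (nonnegRatEnum b.unpair.2 : ℝ) < v) :
    ∀ᶠ k in atTop, BallWithin n (p k) b k v := by
  have h0 : Tendsto (fun k : ℕ => dist (ratPoint n (p k)) (ratPoint n b.unpair.1) +
      (nonnegRatEnum b.unpair.2 : ℝ) + (1 / 2 : ℝ) ^ k) atTop
      (𝓝 (dist x (ratPoint n b.unpair.1) + (nonnegRatEnum b.unpair.2 : ℝ) + 0)) :=
    ((hx.2.dist tendsto_const_nhds).add_const _).add
      (tendsto_pow_atTop_nhds_zero_of_lt_one (by norm_num) (by norm_num))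
  rw [add_zero] at h0
  filter_upwards [h0.eventually_lt_const h] with k hk
  rw [ballWithin_iff]
  linarith

theorem exists_ball_near {n : ℕ} {p : ℕ → ℕ} {A : NonemptyClosed (EuclideanSpace ℝ (Fin n))}
    (hp : (euclideanClosedRep n).IsName p A) {a : EuclideanSpace ℝ (Fin n)} (ha : a ∈ A.1) {η : ℝ}
    (hη : 0 < η) : ∃ t, dist a (ratPoint n (p t).unpair.1) < η ∧
      (nonnegRatEnum (p t).unpair.2 : ℝ) < η := by
  obtain ⟨b, hab, hb⟩ := exists_mem_basicBall_radius_lt (denseRange_ratPoint n) a hη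
  obtain ⟨t, rfl⟩ := (hp b).2 ⟨a, hab, ha⟩
  exact ⟨t, (mem_ball.1 hab).trans hb, hb⟩

/-- The `j`-th bound for the distance between a point and a closed set whose names start with the
symbols paired in `v`. -/
def level (n N v j : ℕ) : ℚ :=
  (2 + sqDist n v.unpair.1 v.unpair.2.unpair.1 + nonnegRatEnum v.unpair.2.unpair.2) *
    ((N : ℚ) / (N + 1)) ^ j

theorem level_pos {n N v j : ℕ} (hN : 0 < N) : 0 < level n N v j := by
  have h1 := sqDist_nonneg n v.unpair.1 v.unpair.2.unpair.1
  have h2 := nonnegRatEnum_nonneg v.unpair.2.unpair.2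
  have h3 : (0 : ℚ) < N := by exact_mod_cast hN
  unfold level
  positivity

theorem level_succ {n N v j : ℕ} :
    (N + 1) * level n N v (j + 1) = N * level n N v j := by
  have : (N : ℚ) + 1 ≠ 0 := by positivity
  unfold level
  rw [pow_succ]
  field_simp

theorem level_antitone {n N v : ℕ} (hN : 0 < N) : Antitone (level n N v) :=
  antitone_nat_of_succ_le fun j => by
    have h1 := level_succ (n := n) (N := N) (v := v) (j := j)
    have h2 := level_pos (n := n) (v := v) (j := j + 1) hN
    have h3 : (0 : ℚ) < N := by exact_mod_cast hN
    exact le_of_mul_le_mul_left (by linarith) h3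

theorem tendsto_level {n N v : ℕ} :
    Tendsto (fun j => (level n N v j : ℝ)) atTop (𝓝 0) := by
  have h : Tendsto (fun j : ℕ => ((N : ℝ) / (N + 1)) ^ j) atTop (𝓝 0) :=
    tendsto_pow_atTop_nhds_zero_of_lt_one (by positivity)
      ((div_lt_one (by positivity)).2 (lt_add_one _))
  simp only [level]
  push_cast
  simpa using h.const_mul _

/-- The first symbols of the names already bound the distance. Of the constant `2` in `level`, one
unit covers the error of `p 0` and the other comes from `√t ≤ 1 + t`. -/
theorem infDist_lt_level_zero {n N : ℕ} {p r : ℕ → ℕ} {x : EuclideanSpace ℝ (Fin n)}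
    {A : NonemptyClosed (EuclideanSpace ℝ (Fin n))} (hp : (euclideanRep n).IsName p x)
    (hr : (euclideanClosedRep n).IsName r A) :
    infDist x A.1 < level n N (pairName p r 0) 0 := by
  obtain ⟨a, hab, haA⟩ := (hr (r 0)).1 ⟨0, rfl⟩
  rw [basicBall, mem_ball] at hab
  have h1 := infDist_le_dist_of_mem haA (x := x)
  have h3 := dist_triangle4 x (ratPoint n (p 0)) (ratPoint n (r 0).unpair.1) a
  have h4 := dist_le_of_cauchyRep hp 0
  have h5 := dist_ratPoint n (p 0) (r 0).unpair.1
  have h6 : √(sqDist n (p 0) (r 0).unpair.1 : ℝ) ≤ 1 + (sqDist n (p 0) (r 0).unpair.1 : ℝ) := by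
    have : (0 : ℝ) ≤ (sqDist n (p 0) (r 0).unpair.1 : ℝ) := by exact_mod_cast sqDist_nonneg _ _ _
    rw [Real.sqrt_le_left (by linarith)]
    nlinarith
  rw [level, pairName, Nat.unpair_pair]
  push_cast
  rw [dist_comm] at h4 hab
  simp only [pow_zero, mul_one] at h4 ⊢
  linarith

/-! ### Machines for levels of the distance and for the projection -/

section ProjToSort

variable (n N : ℕ)

open Classical in
/-- The symbol written at time `k` by the machine that writes a `0` whenever it finds that the
distance is below the next level. -/
noncomputable def distStep (w out : List ℕ) : ℕ :=
  if BallWithin n (w.getD (w.length - 1) 0).unpair.1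
    (w.getD (w.length - 1).unpair.1 0).unpair.2 (w.length - 1)
    (level n N (w.getD 0 0) (zeroCount out + 1)) then 0 else 1

section Primrec

variable {α : Type*} [Primcodable α]

theorem primrecRat_level {v j : α → ℕ} (hv : Primrec v) (hj : Primrec j) :
    PrimrecRat fun x => level n N (v x) (j x) := by
  have hu := Primrec.unpair.comp hv
  have huu := Primrec.unpair.comp (Primrec.snd.comp hu)
  exact (((PrimrecRat.const 2).add (primrecRat_sqDist n (Primrec.fst.comp hu)
    (Primrec.fst.comp huu))).add (PrimrecRat.nonnegRatEnum.comp (Primrec.snd.comp huu))).mul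
    (PrimrecRat.pow (by positivity) hj)

theorem primrecPred_ballWithin {a b k : α → ℕ} {v : α → ℚ} (ha : Primrec a) (hb : Primrec b)
    (hk : Primrec k) (hv : PrimrecRat v) :
    PrimrecPred fun x => BallWithin n (a x) (b x) (k x) (v x) :=
  have hu := Primrec.unpair.comp hb
  primrecPred_ratDistLt n ha (Primrec.fst.comp hu)
    ((hv.sub (PrimrecRat.nonnegRatEnum.comp (Primrec.snd.comp hu))).sub
      (PrimrecRat.pow (by norm_num) hk))

end Primrec

theorem primrec_distStep : Primrec₂ (distStep n N) := by
  classical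
  have hk : Primrec fun x : List ℕ × List ℕ => x.1.length - 1 :=
    Primrec.nat_sub.comp (Primrec.list_length.comp Primrec.fst) (Primrec.const 1)
  have hget : ∀ {i : List ℕ × List ℕ → ℕ}, Primrec i → Primrec fun x : List ℕ × List ℕ => x.1.getD (i x) 0 :=
    fun hi => (Primrec.list_getD 0).comp Primrec.fst hi
  exact Primrec.ite (primrecPred_ballWithin n
    (Primrec.fst.comp (Primrec.unpair.comp (hget hk)))
    (Primrec.snd.comp (Primrec.unpair.comp (hget (Primrec.fst.comp (Primrec.unpair.comp hk)))))
    hk (primrecRat_level n N (hget (Primrec.const 0))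
      (Primrec.succ.comp (primrec_zeroCount.comp Primrec.snd))))
    (Primrec.const 0) (Primrec.const 1)

open Classical in
/-- The machine that finds an approximate projection with the help of the sorted sequence: as long
as only zeros have been read it follows the given point, and afterwards it follows balls that meet
the closed set, are close to the previous output and lie within the last level. -/
noncomputable def projStep (w out : List ℕ) : Option ℕ :=
  if w.findIdx (fun v => decide (v.unpair.2 ≠ 0)) < w.length then
    if BallWithin n (w.getD (w.length - 1) 0).unpair.1.unpair.1
        (w.getD (w.length - 1).unpair.1 0).unpair.1.unpair.2 (w.length - 1)
        (level n N (w.getD 0 0).unpair.1 (w.findIdx fun v => decide (v.unpair.2 ≠ 0))) ∧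
      nonnegRatEnum (w.getD (w.length - 1).unpair.1 0).unpair.1.unpair.2.unpair.2 <
        (1 / 2) ^ (out.length + 2) ∧
      (out.length = 0 ∨
        RatDistLt n (w.getD (w.length - 1).unpair.1 0).unpair.1.unpair.2.unpair.1
          (out.getD (out.length - 1) 0) ((1 / 2) ^ (out.length + 1)))
    then some (w.getD (w.length - 1).unpair.1 0).unpair.1.unpair.2.unpair.1 else none
  else if out.length + 4 < w.length ∧
      level n N (w.getD 0 0).unpair.1 w.length < (1 / 2) ^ (out.length + 4)
    then some (w.getD (out.length + 4) 0).unpair.1.unpair.1 else none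

theorem primrec_projStep : Primrec₂ (projStep n N) := by
  classical
  have hL : Primrec fun x : List ℕ × List ℕ => x.1.length := Primrec.list_length.comp Primrec.fst
  have hi : Primrec fun x : List ℕ × List ℕ => x.2.length := Primrec.list_length.comp Primrec.snd
  have hk : Primrec fun x : List ℕ × List ℕ => x.1.length - 1 :=
    Primrec.nat_sub.comp hL (Primrec.const 1)
  have hget : ∀ {i : List ℕ × List ℕ → ℕ}, Primrec i → Primrec fun x : List ℕ × List ℕ => x.1.getD (i x) 0 :=
    fun hi => (Primrec.list_getD 0).comp Primrec.fst hi
  have hadd : ∀ c, Primrec fun x : List ℕ × List ℕ => x.2.length + c := fun c =>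
    Primrec.nat_add.comp hi (Primrec.const c)
  have hp : ∀ {i : List ℕ × List ℕ → ℕ}, Primrec i →
      Primrec fun x : List ℕ × List ℕ => (x.1.getD (i x) 0).unpair.1.unpair :=
    fun hi => Primrec.unpair.comp (Primrec.fst.comp (Primrec.unpair.comp (hget hi)))
  have hw0 := Primrec.fst.comp (Primrec.unpair.comp (hget (Primrec.const 0)))
  have hb := Primrec.snd.comp (hp (Primrec.fst.comp (Primrec.unpair.comp hk)))
  have hbu := Primrec.unpair.comp hb
  have hm : Primrec fun x : List ℕ × List ℕ =>
      x.1.findIdx (fun v => decide (v.unpair.2 ≠ 0)) :=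
    Primrec.list_findIdx Primrec.fst (PrimrecPred.decide (PrimrecPred.not (Primrec.eq.comp
      (Primrec.snd.comp (Primrec.unpair.comp Primrec.snd)) (Primrec.const 0)))).to₂
  have hpow : ∀ c, PrimrecRat fun x : List ℕ × List ℕ => (1 / 2 : ℚ) ^ (x.2.length + c) :=
    fun c => PrimrecRat.pow (by norm_num) (hadd c)
  have hlast : Primrec fun x : List ℕ × List ℕ => x.2.getD (x.2.length - 1) 0 :=
    (Primrec.list_getD 0).comp Primrec.snd (Primrec.nat_sub.comp hi (Primrec.const 1))
  have hF := (primrecPred_ballWithin n (Primrec.fst.comp (hp hk)) hb hk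
    (primrecRat_level n N hw0 hm)).and (((PrimrecRat.nonnegRatEnum.comp
      (Primrec.snd.comp hbu)).lt (hpow 2)).and ((Primrec.eq.comp hi (Primrec.const 0)).or
        (primrecPred_ratDistLt n (Primrec.fst.comp hbu) hlast (hpow 1))))
  have hZ := (Primrec.nat_lt.comp (hadd 4) hL).and ((primrecRat_level n N hw0 hL).lt (hpow 4))
  exact Primrec.ite (Primrec.nat_lt.comp hm hL)
    (Primrec.ite hF (Primrec.option_some.comp (Primrec.fst.comp hbu)) (Primrec.const none))
    (Primrec.ite hZ (Primrec.option_some.comp (Primrec.fst.comp (hp (hadd 4))))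
      (Primrec.const none))

end ProjToSort

/-! ### Correctness of the two machines -/

section ProjToSort

variable {n N : ℕ} {p r : ℕ → ℕ} {x : EuclideanSpace ℝ (Fin n)}
  {A : NonemptyClosed (EuclideanSpace ℝ (Fin n))}

theorem ite_zero_one_eq_zero_iff {c : Prop} {_ : Decidable c} : (if c then 0 else 1 : ℕ) = 0 ↔ c := by
  split_ifs with h <;> simp [h]

theorem ite_some_none_eq_some_iff {c : Prop} {_ : Decidable c} {a b : ℕ} :
    (if c then some a else none) = some b ↔ c ∧ a = b := by
  split_ifs with h <;> simp [h]

theorem cast_lt_half_pow {v : ℚ} {i : ℕ} : (v : ℝ) < (1 / 2) ^ i ↔ v < (1 / 2) ^ i := by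
  rw [← Rat.cast_lt (K := ℝ)]
  push_cast
  rfl

theorem half_pow_eq (i c : ℕ) : (1 / 2 : ℝ) ^ i = 2 ^ c * (1 / 2) ^ (i + c) := by
  rw [pow_add, mul_left_comm, ← mul_pow]
  norm_num

theorem level_cast_antitone (hN : 0 < N) {v i k : ℕ} (h : i ≤ k) :
    (level n N v k : ℝ) ≤ level n N v i := by
  exact_mod_cast level_antitone hN h

/-- A ball meeting `A`, well within distance `v` of `x`, small, and with its centre close to a given
point of `A`. -/
theorem exists_ballWithin (hp : (euclideanRep n).IsName p x)
    (hr : (euclideanClosedRep n).IsName r A) {a : EuclideanSpace ℝ (Fin n)} (ha : a ∈ A.1) {v : ℚ}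
    (hv : dist x a < v) {η : ℝ} (hη : 0 < η) (l : ℕ) :
    ∃ k, l ≤ k ∧ BallWithin n (p k) (r k.unpair.1) k v ∧
      dist a (ratPoint n (r k.unpair.1).unpair.1) < η ∧
      (nonnegRatEnum (r k.unpair.1).unpair.2 : ℝ) < η := by
  obtain ⟨t, ht1, ht2⟩ := exists_ball_near hr ha (lt_min hη (half_pos (sub_pos.2 hv)))
  rw [lt_min_iff] at ht1 ht2
  have h := eventually_ballWithin hp (b := r t) (v := v) (by
    linarith [dist_triangle x a (ratPoint n (r t).unpair.1)])
  obtain ⟨K, hK⟩ := eventually_atTop.1 h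
  have hle := Nat.right_le_pair t (max l K)
  refine ⟨Nat.pair t (max l K), (le_max_left _ _).trans hle, ?_⟩
  simp only [Nat.unpair_pair]
  exact ⟨hK _ ((le_max_right _ _).trans hle), ht1.1, ht2.1⟩

/-- Each zero certifies that the next level has been passed. Conversely, a level that is passed is
witnessed by arbitrarily late successful tests. -/
theorem exists_name_dist_levels (hN : 0 < N) (hp : (euclideanRep n).IsName p x)
    (hr : (euclideanClosedRep n).IsName r A) :
    ∃ c ∈ machineFun (fun w out => some (distStep n N w out)) (pairName p r),
      ∃ z, cantorRep.IsName c z ∧ ∀ j, sortFun z j = 0 ↔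
        infDist x A.1 < level n N (pairName p r 0) (j + 1) := by
  obtain ⟨c, hc, hstep⟩ := exists_mem_machineFun_of_total (g := distStep n N) (pairName p r)
  have hv : ∀ i, c i = 0 ↔ BallWithin n (p i) (r i.unpair.1) i
      (level n N (pairName p r 0) (Nat.count (fun i => c i = 0) i + 1)) := fun i => by
    rw [hstep, distStep, length_initialWord, Nat.add_sub_cancel, zeroCount_initialWord,
      getD_initialWord _ (Nat.lt_succ_self i), getD_initialWord _ (Nat.succ_pos i),
      getD_initialWord _ (Nat.lt_succ_of_le (Nat.unpair_left_le i)), ite_zero_one_eq_zero_iff]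
    simp only [pairName, Nat.unpair_pair]
  have hname : cantorRep.IsName c fun i => if c i = 0 then 0 else 1 := fun i => by
    have h : c i = 0 ∨ c i = 1 := by
      rw [hstep, distStep]
      split_ifs <;> simp
    rcases h with h | h <;> simp [h]
  refine ⟨c, hc, _, hname, fun j => ?_⟩
  rw [sortFun_eq_zero_iff hname]
  constructor
  · rintro ⟨k, hk⟩
    refine lt_of_lt_of_le ?_ (level_cast_antitone hN (Nat.succ_le_of_lt hk))
    clear hk
    induction k with
    | zero => simpa using infDist_lt_level_zero hp hr
    | succ k ih =>
      rw [Nat.count_succ]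
      split_ifs with h
      · obtain ⟨a, hab, haA⟩ := (hr (r k.unpair.1)).1 ⟨_, rfl⟩
        exact (infDist_le_dist_of_mem haA).trans_lt
          (((hv k).1 h).dist_lt (dist_le_of_cauchyRep hp k) hab)
      · exact ih
  · have hmain : ∀ j k, j ≤ Nat.count (fun i => c i = 0) k →
        infDist x A.1 < level n N (pairName p r 0) (j + 1) →
        ∃ k, j < Nat.count (fun i => c i = 0) k := by
      intro j k hjk hj
      obtain ⟨a, haA, ha⟩ := (infDist_lt_iff A.2.2).1 hj
      obtain ⟨l, hl, hb, -, -⟩ := exists_ballWithin hp hr haA ha one_pos k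
      -- If the count never exceeded `j`, it would equal `j` at time `l`, where the test against
      -- `level (j + 1)` succeeds and writes another zero.
      by_contra! hno
      have hcount : Nat.count (fun i => c i = 0) l = j :=
        le_antisymm (hno l) (hjk.trans (Nat.count_monotone _ hl))
      have h := hno (l + 1)
      rw [← hcount] at hb
      rw [Nat.count_succ, if_pos ((hv l).2 hb)] at h
      omega
    intro hj
    induction j with
    | zero => exact hmain 0 0 (Nat.zero_le _) hj
    | succ j ih =>
      obtain ⟨k, hk⟩ := ih (hj.trans_le (level_cast_antitone hN (Nat.le_succ _)))
      exact hmain (j + 1) k hk hj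

/-- `findIdx` returns the length when nothing is found, so comparing it with the length tells
whether a nonzero sorted symbol has been read. -/
theorem findIdx_initialWord {p s : ℕ → ℕ} {m : ℕ} (hs : ∀ j < m, s j = 0) {k : ℕ} :
    (k ≤ m → (initialWord (pairName p s) k).findIdx (fun v => decide (v.unpair.2 ≠ 0)) = k) ∧
      (s m ≠ 0 → m < k →
        (initialWord (pairName p s) k).findIdx (fun v => decide (v.unpair.2 ≠ 0)) = m) := by
  have hget : ∀ (i : ℕ) (h : i < (initialWord (pairName p s) k).length),
      (initialWord (pairName p s) k)[i].unpair.2 = s i := fun i h => by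
    simp [initialWord, pairName]
  constructor
  · intro h
    refine (List.findIdx_eq_length.2 fun v hv => ?_).trans (length_initialWord _ _)
    obtain ⟨i, hi, rfl⟩ := List.getElem_of_mem hv
    rw [hget i hi, hs i (by rw [length_initialWord] at hi; omega)]
    simp
  · intro hm h
    have hlen : m < (initialWord (pairName p s) k).length := by rwa [length_initialWord]
    rw [List.findIdx_eq hlen]
    refine ⟨by rw [hget m hlen]; simpa using hm, fun j hj => ?_⟩
    rw [hget j, hs j hj]
    simp

theorem projStep_eq_some_iff_of_lt {s : ℕ → ℕ} {k : ℕ} (hs : ∀ j < k + 1, s j = 0) {out : List ℕ}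
    {c : ℕ} : projStep n N (initialWord (pairName (pairName p r) s) (k + 1)) out = some c ↔
      (out.length + 4 < k + 1 ∧
        level n N (pairName p r 0) (k + 1) < (1 / 2) ^ (out.length + 4)) ∧
      p (out.length + 4) = c := by
  have e0 : (pairName (pairName p r) s 0).unpair.1 = pairName p r 0 := by simp [pairName]
  have e1 : ∀ i, (pairName (pairName p r) s i).unpair.1.unpair.1 = p i := by simp [pairName]
  rw [projStep, (findIdx_initialWord hs).1 le_rfl, length_initialWord, if_neg (lt_irrefl _),
    ite_some_none_eq_some_iff, getD_initialWord _ (Nat.succ_pos k), e0]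
  refine and_congr_right fun h => ?_
  rw [getD_initialWord _ h.1, e1]

theorem projStep_eq_some_iff_of_le {s : ℕ → ℕ} {k m : ℕ} (hs : ∀ j < m, s j = 0) (hm : s m ≠ 0)
    (hk : m ≤ k) {out : List ℕ} {c : ℕ} :
    projStep n N (initialWord (pairName (pairName p r) s) (k + 1)) out = some c ↔
      (BallWithin n (p k) (r k.unpair.1) k (level n N (pairName p r 0) m) ∧
        nonnegRatEnum (r k.unpair.1).unpair.2 < (1 / 2) ^ (out.length + 2) ∧
        (out.length = 0 ∨ RatDistLt n (r k.unpair.1).unpair.1 (out.getD (out.length - 1) 0)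
          ((1 / 2) ^ (out.length + 1)))) ∧
      (r k.unpair.1).unpair.1 = c := by
  have e0 : (pairName (pairName p r) s 0).unpair.1 = pairName p r 0 := by simp [pairName]
  have e1 : ∀ i, (pairName (pairName p r) s i).unpair.1.unpair.1 = p i := by simp [pairName]
  have e2 : ∀ i, (pairName (pairName p r) s i).unpair.1.unpair.2 = r i := by simp [pairName]
  rw [projStep, (findIdx_initialWord hs).2 hm (by omega), length_initialWord,
    if_pos (by omega : m < k + 1), ite_some_none_eq_some_iff, Nat.add_sub_cancel,
    getD_initialWord _ (Nat.succ_pos k), getD_initialWord _ (Nat.lt_succ_self k),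
    getD_initialWord _ (Nat.lt_succ_of_le (Nat.unpair_left_le k)), e0, e1, e2]

theorem exists_name_of_infDist_eq_zero {s : ℕ → ℕ} (hs : ∀ j, s j = 0)
    (hp : (euclideanRep n).IsName p x) :
    ∃ q ∈ machineFun (projStep n N) (pairName (pairName p r) s), (euclideanRep n).IsName q x := by
  obtain ⟨q, hq, hstep⟩ := exists_mem_machineFun (ψ := projStep n N)
    (p := pairName (pairName p r) s) (fun _ => True) trivial (fun _ _ _ _ _ => trivial)
    (fun k out _ => by
      have h1 : ∀ᶠ l in atTop, (level n N (pairName p r 0) (l + 1) : ℝ) <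
          (1 / 2) ^ (out.length + 4) :=
        ((tendsto_add_atTop_iff_nat 1).2 tendsto_level).eventually_lt_const (by positivity)
      obtain ⟨l, hl, hkl, hol⟩ := (h1.and ((eventually_ge_atTop k).and
        (eventually_ge_atTop (out.length + 4)))).exists
      exact ⟨l, hkl, Option.isSome_iff_exists.2 ⟨_, (projStep_eq_some_iff_of_lt fun j _ => hs j).2
        ⟨⟨Nat.lt_succ_of_le hol, cast_lt_half_pow.1 hl⟩, rfl⟩⟩⟩)
  have hqp : ∀ i, q i = p (i + 4) := fun i => by
    obtain ⟨-, k, -, hk⟩ := hstep i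
    rw [projStep_eq_some_iff_of_lt fun j _ => hs j, length_initialWord] at hk
    exact hk.2.symm
  refine ⟨q, hq, fun i j hij => ?_, ?_⟩
  · rw [hqp, hqp]
    exact (hp.1 _ _ (by omega)).trans
      (pow_le_pow_of_le_one (by norm_num) (by norm_num) (Nat.le_add_right i 4))
  · simp only [hqp]
    exact (tendsto_add_atTop_iff_nat 4).2 hp.2

theorem cauchyRep_isName_of_dist_succ_le {X : Type*} [MetricSpace X] [CompleteSpace X] {α : ℕ → X}
    (hα : DenseRange α) {q : ℕ → ℕ}
    (h : ∀ i, dist (α (q i)) (α (q (i + 1))) ≤ (1 / 2) ^ (i + 1)) :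
    ∃ y, (cauchyRep α hα).IsName q y := by
  have hle : ∀ i j, i ≤ j → dist (α (q i)) (α (q j)) ≤ (1 / 2 : ℝ) ^ i - (1 / 2) ^ j := by
    intro i j hij
    induction j, hij using Nat.le_induction with
    | base => simp
    | succ j _ ih =>
      have h1 := dist_triangle (α (q i)) (α (q j)) (α (q (j + 1)))
      have h2 : (1 / 2 : ℝ) ^ j = 2 * (1 / 2) ^ (j + 1) := by rw [pow_succ]; ring
      linarith [h j]
  have hcauchy : CauchySeq fun i => α (q i) :=
    cauchySeq_of_le_geometric_two (C := 1) fun i => (h i).trans (le_of_eq (by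
      rw [pow_succ, one_div_pow]; ring))
  obtain ⟨y, hy⟩ := cauchySeq_tendsto_of_complete hcauchy
  exact ⟨y, fun i j hij => (hle i j hij).trans (sub_le_self _ (by positivity)), hy⟩

/-- Every output, before or after the switch, stays close to some point of `A` within the level. The
outputs converge, and closedness of `A` puts the limit in `A`. -/
theorem exists_name_of_level_le {s : ℕ → ℕ} {m : ℕ} (hN : 0 < N) (hs : ∀ j < m, s j = 0)
    (hm : s m ≠ 0) (hp : (euclideanRep n).IsName p x) (hr : (euclideanClosedRep n).IsName r A)
    (hd : infDist x A.1 < level n N (pairName p r 0) m) :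
    ∃ q ∈ machineFun (projStep n N) (pairName (pairName p r) s),
      ∃ y ∈ A.1, dist x y ≤ level n N (pairName p r 0) m ∧ (euclideanRep n).IsName q y := by
  obtain ⟨a₀, ha₀A, ha₀⟩ := (infDist_lt_iff A.2.2).1 hd
  have hpos : ∀ i : ℕ, (0 : ℝ) < (1 / 2) ^ i := fun i => by positivity
  obtain ⟨q, hq, hstep⟩ := exists_mem_machineFun (ψ := projStep n N)
    (p := pairName (pairName p r) s)
    -- The last symbol has index `out.length - 1`, so the precision for the symbol with index `i` is
    -- `2⁻⁽ⁱ⁺²⁾`.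
    (fun out => out.length ≠ 0 → ∃ a ∈ A.1, dist x a < level n N (pairName p r 0) m ∧
      dist (ratPoint n (out.getD (out.length - 1) 0)) a < (1 / 2) ^ (out.length + 1))
    (fun h => absurd rfl h)
    (fun k out c _ hk _ => by
      have hlast : (out ++ [c]).getD ((out ++ [c]).length - 1) 0 = c := by simp
      rw [hlast, List.length_append, List.length_singleton]
      -- Before the switch the symbol approximates `x`, and `level m ≤ level (k + 1)` is small, so
      -- `a₀` is near it. After the switch its small ball meets `A`.
      rcases Nat.lt_or_ge k m with hkm | hkm
      · rw [projStep_eq_some_iff_of_lt fun j hj => hs j (by omega)] at hk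
        obtain ⟨⟨-, hlev⟩, rfl⟩ := hk
        refine ⟨a₀, ha₀A, ha₀, ?_⟩
        have h1 := dist_le_of_cauchyRep hp (out.length + 4)
        have h2 := dist_triangle (ratPoint n (p (out.length + 4))) x a₀
        have h3 : (level n N (pairName p r 0) (k + 1) : ℝ) < (1 / 2) ^ (out.length + 4) :=
          cast_lt_half_pow.2 hlev
        have h4 : (level n N (pairName p r 0) m : ℝ) ≤ level n N (pairName p r 0) (k + 1) :=
          level_cast_antitone hN (by omega)
        have h5 := half_pow_eq (out.length + 1 + 1) 2
        have h6 := hpos (out.length + 4)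
        linarith
      · rw [projStep_eq_some_iff_of_le hs hm hkm] at hk
        obtain ⟨⟨hb, hrad, -⟩, rfl⟩ := hk
        obtain ⟨a, hab, haA⟩ := (hr (r k.unpair.1)).1 ⟨_, rfl⟩
        refine ⟨a, haA, hb.dist_lt (dist_le_of_cauchyRep hp k) hab, ?_⟩
        rw [dist_comm]
        exact (mem_ball.1 hab).trans (cast_lt_half_pow.2 hrad))
    (fun k out hinv => by
      obtain ⟨a, haA, ha, hlast⟩ : ∃ a ∈ A.1, dist x a < level n N (pairName p r 0) m ∧
          (out.length = 0 ∨ dist (ratPoint n (out.getD (out.length - 1) 0)) a <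
            (1 / 2) ^ (out.length + 1)) := by
        by_cases h0 : out.length = 0
        · exact ⟨a₀, ha₀A, ha₀, Or.inl h0⟩
        · obtain ⟨a, haA, ha, h⟩ := hinv h0
          exact ⟨a, haA, ha, Or.inr h⟩
      -- The invariant is strict, which leaves room for a ball centre near `a` that is still close
      -- enough to the previous output.
      obtain ⟨η, hη, hη1, hη2⟩ : ∃ η : ℝ, 0 < η ∧ η ≤ (1 / 2) ^ (out.length + 2) ∧
          (out.length = 0 ∨ dist (ratPoint n (out.getD (out.length - 1) 0)) a + η ≤
            (1 / 2) ^ (out.length + 1)) := by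
        rcases hlast with h | h
        · exact ⟨_, hpos _, le_rfl, Or.inl h⟩
        · exact ⟨_, lt_min (hpos (out.length + 2)) (sub_pos.2 h), min_le_left _ _,
            Or.inr (le_sub_iff_add_le'.1 (min_le_right _ _))⟩
      obtain ⟨l, hl, hb, hc, hrad⟩ := exists_ballWithin hp hr haA ha hη (max k m)
      refine ⟨l, (le_max_left _ _).trans hl, Option.isSome_iff_exists.2 ⟨_,
        (projStep_eq_some_iff_of_le hs hm ((le_max_right _ _).trans hl)).2
          ⟨⟨hb, cast_lt_half_pow.1 (hrad.trans_le hη1), hη2.imp_right fun h => ?_⟩, rfl⟩⟩⟩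
      rw [ratDistLt_iff]
      push_cast
      rw [dist_comm]
      exact (dist_triangle _ a _).trans_lt (by linarith))
  have happrox : ∀ i, ∃ a ∈ A.1, dist x a < level n N (pairName p r 0) m ∧
      dist (ratPoint n (q i)) a < (1 / 2) ^ (i + 2) := fun i => by
    have h := (hstep (i + 1)).1
    rw [length_initialWord, Nat.add_sub_cancel, getD_initialWord _ (Nat.lt_succ_self i)] at h
    exact h (Nat.succ_ne_zero i)
  have hsucc : ∀ i, dist (ratPoint n (q i)) (ratPoint n (q (i + 1))) ≤ (1 / 2) ^ (i + 1) := by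
    intro i
    obtain ⟨-, k, -, hk⟩ := hstep (i + 1)
    -- Before the switch, compare through `a` and `x`: `2⁻⁽ⁱ⁺²⁾ + 2 · 2⁻⁽ⁱ⁺⁵⁾` is below `2⁻⁽ⁱ⁺¹⁾`.
    -- After it, the machine has tested closeness directly.
    rcases Nat.lt_or_ge k m with hkm | hkm
    · rw [projStep_eq_some_iff_of_lt fun j hj => hs j (by omega), length_initialWord] at hk
      obtain ⟨⟨-, hlev⟩, hqi⟩ := hk
      obtain ⟨a, -, ha, hqa⟩ := happrox i
      have h1 := dist_le_of_cauchyRep hp (i + 1 + 4)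
      rw [hqi] at h1
      have h2 := dist_triangle4 (ratPoint n (q i)) a x (ratPoint n (q (i + 1)))
      have h3 : (level n N (pairName p r 0) (k + 1) : ℝ) < (1 / 2) ^ (i + 1 + 4) :=
        cast_lt_half_pow.2 hlev
      have h4 : (level n N (pairName p r 0) m : ℝ) ≤ level n N (pairName p r 0) (k + 1) :=
        level_cast_antitone hN (by omega)
      rw [dist_comm] at h1
      rw [dist_comm] at ha
      have h5 := half_pow_eq (i + 1) 4
      have h6 := half_pow_eq (i + 2) 3
      have h7 := hpos (i + 1 + 4)
      linarith
    · rw [projStep_eq_some_iff_of_le hs hm hkm, length_initialWord, Nat.add_sub_cancel,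
        getD_initialWord _ (Nat.lt_succ_self i)] at hk
      obtain ⟨⟨-, -, h⟩, hqi⟩ := hk
      have h := h.resolve_left (Nat.succ_ne_zero i)
      rw [hqi, ratDistLt_iff, dist_comm] at h
      push_cast at h
      exact h.le.trans (pow_le_pow_of_le_one (by norm_num) (by norm_num) (Nat.le_succ _))
  obtain ⟨y, hy⟩ := cauchyRep_isName_of_dist_succ_le (denseRange_ratPoint n) hsucc
  choose a haA hxa hqa using happrox
  have hay : Tendsto a atTop (𝓝 y) := by
    refine hy.2.congr_dist (squeeze_zero (fun _ => dist_nonneg) (fun i => (hqa i).le) ?_)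
    exact (tendsto_add_atTop_iff_nat 2).2
      (tendsto_pow_atTop_nhds_zero_of_lt_one (r := (1 / 2 : ℝ)) (by norm_num) (by norm_num))
  exact ⟨q, hq, y, A.2.1.mem_of_tendsto hay (Eventually.of_forall haA),
    le_of_tendsto (tendsto_const_nhds.dist hay) (Eventually.of_forall fun i => (hxa i).le), hy⟩

theorem approxProj_reducible_sort {ε : ℝ} (hε : 0 < ε) (n : ℕ) :
    WeihrauchReducible ((euclideanRep n).prod (euclideanClosedRep n)) (euclideanRep n)
      (approxProj (X := EuclideanSpace ℝ (Fin n)) ε)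
      cantorRep cantorRep (fun p : ℕ → Fin 2 => {sortFun p}) := by
  obtain ⟨N, hN0, hN⟩ : ∃ N : ℕ, 0 < N ∧ (N + 1 : ℝ) ≤ N * (1 + ε) := by
    obtain ⟨N, hN⟩ := exists_nat_gt (1 / ε)
    have h := (div_lt_iff₀ hε).1 hN
    exact ⟨N, by exact_mod_cast (by positivity : 0 < 1 / ε).trans hN, by linarith⟩
  refine ⟨machineFun (projStep n N), machineFun fun w out => some (distStep n N w out),
    typeTwoComputable_machineFun (primrec_projStep n N),
    typeTwoComputable_machineFun (Primrec.option_some.comp (primrec_distStep n N)), ?_⟩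
  rintro G hG _ ⟨x, A⟩ ⟨p, r, rfl, hp, hr⟩ -
  obtain ⟨c, hc, z, hz, hsort⟩ := exists_name_dist_levels hN0 hp hr
  obtain ⟨s, hs, _, rfl, hsn⟩ := hG c z hz ⟨_, rfl⟩
  have hs0 : ∀ j, s j = 0 ↔ infDist x A.1 < level n N (pairName p r 0) (j + 1) := fun j => by
    rw [← hsort j, hsn j, Fin.ext_iff, Fin.val_zero]
  suffices h : ∃ q ∈ machineFun (projStep n N) (pairName (pairName p r) s),
      ∃ y ∈ approxProj ε (x, A), (euclideanRep n).IsName q y by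
    obtain ⟨q, hq, hy⟩ := h
    exact ⟨q, Part.mem_bind hc (Part.mem_bind hs hq), hy⟩
  by_cases hall : ∀ j, s j = 0
  · have hd : infDist x A.1 = 0 := le_antisymm
      (ge_of_tendsto ((tendsto_add_atTop_iff_nat 1).2 (tendsto_level (n := n) (N := N)))
        (Eventually.of_forall fun j => ((hs0 j).1 (hall j)).le)) infDist_nonneg
    obtain ⟨q, hq, hqn⟩ := exists_name_of_infDist_eq_zero (N := N) (r := r) hall hp
    refine ⟨q, hq, x, ⟨(A.2.1.mem_iff_infDist_zero A.2.2).2 hd, ?_⟩, hqn⟩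
    simp [hd]
  · classical
    rw [not_forall] at hall
    have hm := Nat.find_spec hall
    have hlt : ∀ j < Nat.find hall, s j = 0 := fun j hj => not_not.1 (Nat.find_min hall hj)
    generalize Nat.find hall = m at hm hlt
    have hdm : infDist x A.1 < level n N (pairName p r 0) m := by
      -- When no zero is returned, only the a priori bound `level 0` is available.
      cases m with
      | zero => exact infDist_lt_level_zero hp hr
      | succ m => exact (hs0 m).1 (hlt m (Nat.lt_succ_self m))
    obtain ⟨q, hq, y, hyA, hyd, hqn⟩ := exists_name_of_level_le hN0 hlt hm hp hr hdm
    refine ⟨q, hq, y, ⟨hyA, hyd.trans ?_⟩, hqn⟩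
    -- The first nonzero symbol bounds the distance below by `level (m + 1)`, and `level m` exceeds
    -- that by a factor of at most `1 + ε`.
    have h1 := not_lt.1 (mt (hs0 m).2 hm)
    have h2 : (N + 1 : ℝ) * level n N (pairName p r 0) (m + 1) =
        N * level n N (pairName p r 0) m := by exact_mod_cast level_succ
    have h3 : (0 : ℝ) < N := by exact_mod_cast hN0
    have h4 : (0 : ℝ) ≤ level n N (pairName p r 0) (m + 1) := by
      exact_mod_cast (level_pos hN0).le
    refine le_of_mul_le_mul_left ?_ h3
    calc (N : ℝ) * level n N (pairName p r 0) m
        = (N + 1) * level n N (pairName p r 0) (m + 1) := h2.symm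
      _ ≤ N * (1 + ε) * level n N (pairName p r 0) (m + 1) := by gcongr
      _ ≤ N * (1 + ε) * infDist x A.1 := by gcongr
      _ = N * ((1 + ε) * infDist x A.1) := by ring

end ProjToSort

theorem mainTheorem8 (ε : ℝ) (hε : 0 < ε) (n : ℕ) (hn : 1 ≤ n) :
    WeihrauchEquivalent
      ((euclideanRep n).prod (euclideanClosedRep n)) (euclideanRep n)
      (approxProj (X := EuclideanSpace ℝ (Fin n)) ε)
      cantorRep cantorRep (fun p : ℕ → Fin 2 => {sortFun p}) :=
  ⟨approxProj_reducible_sort hε n, sort_reducible_approxProj hε hn⟩
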